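/- All vector spaces are over $\mathbb C$. For a vector space $W$ put $\mathcal E(W)=\mathrm{Hom}(W,W((x)))$, where $W((x))$ denotes the lower truncated formal Laurent series; $W((x_1,x_2))=W[[x_1,x_2]][x_1^{-1},x_2^{-1}]$. Powers $(x-y)^n$, $n\in\mathbb Z$, are expanded in nonnegative powers of $y$, $\delta(x)=\sum_{n\in\mathbb Z}x^n$, and $\iota_{x_2,x_1}$ denotes the expansion in the field $\mathbb C((x_2))((x_1))$. **Definitions.** * A *weak quantum vertex algebra* is a vector space $V$ with a vector $\mathbf 1\in V$ and a linear map $Y(\cdot,x):V\to\mathrm{Hom}(V,V((x)))$, $Y(v,x)=\sum_{n\in\mathbb Z}v_nx^{-n-1}$, such that $Y(\mathbf 1,x)v=v$, $Y(v,x)\mathbf 1\in V[[x]]$ has constant term $v$ for all $v\in V$, and such that for all $u,v\in V$ there are finitely many $u^{(i)},v^{(i)}\in V$, $f_i\in\mathbb C((x))$ with $$x_0^{-1}\delta\Big(\frac{x_1-x_2}{x_0}\Big)Y(u,x_1)Y(v,x_2)-x_0^{-1}\delta\Big(\frac{x_2-x_1}{-x_0}\Big)\sum_i f_i(x_2-x_1)Y(v^{(i)},x_2)Y(u^{(i)},x_1)=x_2^{-1}\delta\Big(\frac{x_1-x_0}{x_2}\Big)Y(Y(u,x_0)v,x_2).$$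 An *automorphism* of $V$ is a bijective linear map $\sigma:V\to V$ with $\sigma(\mathbf 1)=\mathbf 1$ and $\sigma(Y(u,x)v)=Y(\sigma u,x)\sigma v$ for all $u,v\in V$. * $V$ is of *$T$-type* if for all $u,v\in V$ there are finitely many $u^{(i)},v^{(i)}\in V$, $f_i\in\mathbb C(x)$ and $k\in\mathbb N$ with $$(x_1-x_2)^kY(u,x_1)Y(v,x_2)=(x_1-x_2)^k\sum_i\iota_{x_2,x_1}\big(f_i(e^{x_1-x_2})\big)Y(v^{(i)},x_2)Y(u^{(i)},x_1).$$ * A subset $U\subset V$ is *generating* if $V$ is linearly spanned by the vectors $u^{(1)}_{n_1}\cdots u^{(r)}_{n_r}\mathbf 1$ with $r\in\mathbb N$, $u^{(i)}\in U$, $n_i\in\mathbb Z$. * A *$\phi$-coordinated quasi $V$-module* is a vector space $W$ with a linear map $Y_W(\cdot,x):V\to\mathcal E(W)$ such that $Y_W(\mathbf 1,x)=1_W$ and such that for all $u,v\in V$ there is a nonzero $p(x)\in\mathbb C[x]$ with $p(x_1/x_2)Y_W(u,x_1)Y_W(v,x_2)\in\mathrm{Hom}(W,W((x_1,x_2)))$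 and $$p(e^z)Y_W(Y(u,z)v,x_2)=\big(p(x_1/x_2)Y_W(u,x_1)Y_W(v,x_2)\big)\big|_{x_1=x_2e^z}.$$ * For a subgroup $\Gamma\subset\mathbb C^\times$, a subset $S\subset\mathcal E(W)$ is *$\Gamma$-quasi $\mathcal S_{trig}$-local* if for all $a,b\in S$ there are finitely many $a^{(i)},b^{(i)}\in S$, $f_i\in\mathbb C(x)$ and a nonzero $p(x)\in\mathbb C[x]$, all of whose zeros lie in $\Gamma$, with $$p(x/z)a(x)b(z)=p(x/z)\sum_i\iota_{z,x}\big(f_i(z/x)\big)b^{(i)}(z)a^{(i)}(x).$$ * Let $V$ be a $T$-type weak quantum vertex algebra, let $G$ be a group acting on $V$ by automorphisms, and let $\chi:G\to\mathbb C^\times$ be a linear character (a group homomorphism). A $\phi$-coordinated quasi $V$-module $(W,Y_W)$ is *$G$-covariant* if $Y_W(gv,x)=Y_W(v,\chi(g)x)$ for all $g\in G$, $v\in V$, and if for all $u,v\in V$ there is a nonzero $p(x)\in\mathbb C[x]$, all of whose zeros lie in $\chi(G)$, with $p(x_1/x_2)Y_W(u,x_1)Y_W(v,x_2)\in\mathrm{Hom}(W,W((x_1,x_2)))$.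 **Lemma 4.20.** Let $V$ be a $T$-type weak quantum vertex algebra, let $G$ be a group acting on $V$ by automorphisms, with a linear character $\chi:G\to\mathbb C^\times$, and let $(W,Y_W)$ be a $\phi$-coordinated quasi $V$-module. Suppose that $U$ is a generating subset of $V$ such that $$Y_W(gu,x)=Y_W(u,\chi(g)x)\quad\text{for all }u\in U,\ g\in G,$$ and such that $\{Y_W(u,x)\mid u\in U\}$ is $\chi(G)$-quasi $\mathcal S_{trig}$-local. Then $(W,Y_W)$ is a $G$-covariant $\phi$-coordinated quasi $V$-module. -/

import Mathlib

namespace PhiQVA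

noncomputable section

universe u v

/-! ### Formal series

A formal series with coefficients in `W`, infinite in all directions, is a function
`Γ → W` on the group `Γ` of exponents: `Γ = ℤ × ℤ` for two variables and
`Γ = ℤ × ℤ × ℤ` for three.  Its value at an exponent is the corresponding coefficient. -/

/-- The product of a scalar series and a vector valued series: the coefficient at `m` is
`∑ i, F i • S (m - i)`.  In all uses below, only finitely many summands are nonzero. -/
def mulSeries {Γ : Type*} [AddGroup Γ] {W : Type*} [AddCommGroup W] [Module ℂ W]
    (F : Γ → ℂ) (S : Γ → W) : Γ → W :=
  fun m => ∑ᶠ i : Γ, F i • S (m - i)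

/-- `(x - y)ⁿ`, for an integer `n`, expanded in nonnegative powers of the second variable `y`:
`∑_{j ≥ 0} (n choose j) (-1)^j x^(n-j) y^j`.  The exponents are those of `(x, y)`. -/
def subPow (n : ℤ) : ℤ × ℤ → ℂ :=
  fun e => if 0 ≤ e.2 ∧ e.1 + e.2 = n then
    (-1 : ℂ) ^ e.2.toNat * ((Ring.choose n e.2.toNat : ℤ) : ℂ) else 0

/-- `f(x₂ - x₁)` for `f ∈ ℂ((x))`, expanded in nonnegative powers of `x₁`.
The exponents are those of `(x₁, x₂)`. -/
def laurentSub (f : LaurentSeries ℂ) : ℤ × ℤ → ℂ :=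
  fun e => f.coeff (e.2 + e.1) * subPow (e.2 + e.1) (e.2, e.1)

/-- `x₀⁻¹ δ((x₁ - x₂)/x₀) = ∑ₙ x₀^(-n-1) (x₁ - x₂)ⁿ`; exponents of `(x₀, x₁, x₂)`. -/
def deltaA : ℤ × ℤ × ℤ → ℂ :=
  fun e => subPow (-e.1 - 1) (e.2.1, e.2.2)

/-- `x₀⁻¹ δ((x₂ - x₁)/(-x₀)) = ∑ₙ (-1)ⁿ x₀^(-n-1) (x₂ - x₁)ⁿ`; exponents of `(x₀, x₁, x₂)`. -/
def deltaB : ℤ × ℤ × ℤ → ℂ :=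
  fun e => (-1 : ℂ) ^ (-e.1 - 1) * subPow (-e.1 - 1) (e.2.2, e.2.1)

/-- `x₂⁻¹ δ((x₁ - x₀)/x₂) = ∑ₙ x₂^(-n-1) (x₁ - x₀)ⁿ`; exponents of `(x₀, x₁, x₂)`. -/
def deltaC : ℤ × ℤ × ℤ → ℂ :=
  fun e => subPow (-e.2.2 - 1) (e.2.1, e.1)

/-- A series in `(x₁, x₂)` as a series in `(x₀, x₁, x₂)`. -/
def inX1X2 {W : Type*} [Zero W] (S : ℤ × ℤ → W) : ℤ × ℤ × ℤ → W :=
  fun e => if e.1 = 0 then S (e.2.1, e.2.2) else 0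

/-- A series in `(x₀, x₂)` as a series in `(x₀, x₁, x₂)`. -/
def inX0X2 {W : Type*} [Zero W] (S : ℤ × ℤ → W) : ℤ × ℤ × ℤ → W :=
  fun e => if e.2.1 = 0 then S (e.1, e.2.2) else 0

/-- `p(x₁/x₂)` for a polynomial `p`; exponents of `(x₁, x₂)`. -/
def polyRatio (p : Polynomial ℂ) : ℤ × ℤ → ℂ :=
  fun e => if 0 ≤ e.1 ∧ e.2 = -e.1 then p.coeff e.1.toNat else 0

/-- `p(e^z) ∈ ℂ[[z]]`, as a series in `(z, x)` not involving `x`. -/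
def polyExp (p : Polynomial ℂ) : ℤ × ℤ → ℂ :=
  fun e => if 0 ≤ e.1 ∧ e.2 = 0 then
    PowerSeries.coeff e.1.toNat (Polynomial.aeval (PowerSeries.exp ℂ) p) else 0

/-- The series lies in `W((x₁, x₂)) = W[[x₁, x₂]][x₁⁻¹, x₂⁻¹]`. -/
def IsLaurent {W : Type*} [Zero W] (S : ℤ × ℤ → W) : Prop :=
  ∃ N : ℤ, ∀ m n : ℤ, S (m, n) ≠ 0 → N ≤ m ∧ N ≤ n

/-- The substitution `A(x₁, x₂)|_{x₁ = x₂ e^z} = ∑_{m,n} A_{m,n} x₂^(m+n) e^{mz}`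
for `A ∈ W((x₁, x₂))`, as a series in `(z, x₂)`. -/
def substExp {W : Type*} [AddCommGroup W] [Module ℂ W] (A : ℤ × ℤ → W) : ℤ × ℤ → W :=
  fun e => if 0 ≤ e.1 then
    ∑ᶠ m : ℤ, ((m : ℂ) ^ e.1.toNat / (e.1.toNat.factorial : ℂ)) • A (m, e.2 - m) else 0

/-! ### The field `ℂ((z))((x))` and the expansion maps `ι` -/

/-- `ℂ((z))((x))`: the inner variable is `z`, the outer variable is `x`. -/
abbrev IterLaurent : Type := LaurentSeries (LaurentSeries ℂ)

/-- The outer variable `x` of `ℂ((z))((x))`. -/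
def outerVar : IterLaurent := HahnSeries.single 1 1

/-- The inner variable `z` of `ℂ((z))((x))`. -/
def innerVar : IterLaurent := HahnSeries.C (HahnSeries.single 1 1)

/-- `e^x` for the outer variable `x`. -/
def expOuter : IterLaurent :=
  HahnSeries.ofPowerSeries ℤ (LaurentSeries ℂ)
    (PowerSeries.map HahnSeries.C (PowerSeries.exp ℂ))

/-- `e^z` for the inner variable `z`. -/
def expInner : IterLaurent :=
  HahnSeries.C (HahnSeries.ofPowerSeries ℤ ℂ (PowerSeries.exp ℂ))

/-- The element `f(t) = p(t)/q(t)` of the field `ℂ((z))((x))`, where `f = p/q ∈ ℂ(x)`.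
(It is used for `t` transcendental over `ℂ`, so that `q(t) ≠ 0`.) -/
def ratEval (f : RatFunc ℂ) (t : IterLaurent) : IterLaurent :=
  RatFunc.eval (HahnSeries.C.comp HahnSeries.C) t f

/-- The coefficients of an element of `ℂ((z))((x))`; exponents of `(x, z)` (outer, inner). -/
def iterCoeff (F : IterLaurent) : ℤ × ℤ → ℂ :=
  fun e => (F.coeff e.1).coeff e.2

/-- `ι_{z,x}(f(z/x))`; exponents of `(x, z)`. -/
def iotaRatio (f : RatFunc ℂ) : ℤ × ℤ → ℂ :=
  iterCoeff (ratEval f (innerVar / outerVar))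

/-- `ι_{x₂,x₁}(f(e^{x₁ - x₂}))`; exponents of `(x₁, x₂)`. -/
def iotaExp (f : RatFunc ℂ) : ℤ × ℤ → ℂ :=
  iterCoeff (ratEval f (expOuter / expInner))

/-! ### Fields on a vector space -/

/-- `ℰ(W) = Hom(W, W((x)))`. -/
abbrev FieldOn (W : Type*) [AddCommGroup W] [Module ℂ W] : Type _ :=
  W →ₗ[ℂ] LaurentSeries W

section Fields

variable {W : Type*} [AddCommGroup W] [Module ℂ W]

/-- The substitution `x ↦ cx` on `W((x))`. -/
def rescale (c : ℂˣ) : LaurentSeries W →ₗ[ℂ] LaurentSeries W where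
  toFun f :=
    { coeff := fun n => ((c ^ n : ℂˣ) : ℂ) • f.coeff n
      isPWO_support' := f.isPWO_support.mono (fun n hn h => hn (by simp [h])) }
  map_add' f g := by
    ext n
    simp
  map_smul' r f := by
    ext n
    simp only [HahnSeries.coeff_smul, RingHom.id_apply]
    exact smul_comm _ _ _

/-- `a(cx)` for `a(x) ∈ ℰ(W)` and `c ∈ ℂˣ`. -/
def FieldOn.scale (c : ℂˣ) (a : FieldOn W) : FieldOn W := rescale c ∘ₗ a

/-- `a(x₁) b(x₂) w`; exponents of `(x₁, x₂)`. -/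
def fieldMul (a b : FieldOn W) (w : W) : ℤ × ℤ → W :=
  fun e => (a ((b w).coeff e.2)).coeff e.1

/-- `b(x₂) a(x₁) w`; exponents of `(x₁, x₂)`. -/
def fieldMulRev (b a : FieldOn W) (w : W) : ℤ × ℤ → W :=
  fun e => (b ((a w).coeff e.1)).coeff e.2

/-- `p(x₁/x₂) a(x₁) b(x₂) ∈ Hom(W, W((x₁, x₂)))`. -/
def IsCompatibleWith (p : Polynomial ℂ) (a b : FieldOn W) : Prop :=
  ∀ w : W, IsLaurent (mulSeries (polyRatio p) (fieldMul a b w))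

/-- `p` is nonzero and all its zeros lie in `Γ`. -/
def ZerosIn (Γ : Subgroup ℂˣ) (p : Polynomial ℂ) : Prop :=
  p ≠ 0 ∧ ∀ t : ℂ, p.IsRoot t → ∃ c ∈ Γ, (c : ℂ) = t

/-- `Γ`-quasi `S_trig`-local subsets of `ℰ(W)`: for any `a, b ∈ S` there are finitely many
`a⁽ⁱ⁾, b⁽ⁱ⁾ ∈ S`, `fᵢ ∈ ℂ(x)` and a nonzero polynomial `p` with zeros only in `Γ`, with
`p(x/z) a(x) b(z) = p(x/z) ∑ᵢ ι_{z,x}(fᵢ(z/x)) b⁽ⁱ⁾(z) a⁽ⁱ⁾(x)`. -/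
def IsQuasiTrigLocal (Γ : Subgroup ℂˣ) (S : Set (FieldOn W)) : Prop :=
  ∀ a ∈ S, ∀ b ∈ S, ∃ (r : ℕ) (a' b' : Fin r → FieldOn W) (f : Fin r → RatFunc ℂ)
    (p : Polynomial ℂ),
    (∀ i, a' i ∈ S) ∧ (∀ i, b' i ∈ S) ∧ ZerosIn Γ p ∧
    ∀ w : W,
      mulSeries (polyRatio p) (fieldMul a b w) =
        mulSeries (polyRatio p)
          (∑ i, mulSeries (iotaRatio (f i)) (fieldMulRev (b' i) (a' i) w))

end Fields

/-! ### Weak quantum vertex algebras -/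

/-- A weak quantum vertex algebra structure on the vector space `V`. -/
structure WeakQVA (V : Type u) [AddCommGroup V] [Module ℂ V] where
  /-- the vacuum vector -/
  vac : V
  /-- the adjoint vertex operator map -/
  Y : V →ₗ[ℂ] FieldOn V
  /-- `Y(1, x) v = v` -/
  vac_left : ∀ v : V, Y vac v = HahnSeries.single 0 v
  /-- `Y(v, x) 1 ∈ V[[x]]` -/
  creation_nonneg : ∀ (v : V) (n : ℤ), n < 0 → (Y v vac).coeff n = 0
  /-- the constant term of `Y(v, x) 1` is `v` -/
  creation_const : ∀ v : V, (Y v vac).coeff 0 = v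
  /-- the `S`-Jacobi identity -/
  jacobi : ∀ u v : V, ∃ (r : ℕ) (u' v' : Fin r → V) (f : Fin r → LaurentSeries ℂ),
    ∀ w : V,
      mulSeries deltaA (inX1X2 (fieldMul (Y u) (Y v) w)) -
        mulSeries deltaB (inX1X2
          (∑ i, mulSeries (laurentSub (f i)) (fieldMulRev (Y (v' i)) (Y (u' i)) w))) =
      mulSeries deltaC (inX0X2 (fun e => (Y ((Y u v).coeff e.1) w).coeff e.2))

namespace WeakQVA

variable {V : Type u} [AddCommGroup V] [Module ℂ V] (A : WeakQVA V)

/-- `uₙ v`, where `Y(u, x) v = ∑ₙ uₙ v x^(-n-1)`. -/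
def mode (u : V) (n : ℤ) (v : V) : V := (A.Y u v).coeff (-n - 1)

/-- The group of automorphisms of a weak quantum vertex algebra. -/
def Aut : Subgroup (V ≃ₗ[ℂ] V) where
  carrier := {σ | σ A.vac = A.vac ∧
    ∀ (u v : V) (n : ℤ), σ ((A.Y u v).coeff n) = (A.Y (σ u) (σ v)).coeff n}
  one_mem' := ⟨rfl, fun _ _ _ => rfl⟩
  mul_mem' := by
    rintro σ τ ⟨h1, h2⟩ ⟨h3, h4⟩
    refine ⟨?_, fun u v n => ?_⟩
    · rw [LinearEquiv.mul_apply, h3, h1]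
    · simp only [LinearEquiv.mul_apply]
      rw [h4, h2]
  inv_mem' := by
    rintro σ ⟨h1, h2⟩
    refine ⟨?_, fun u v n => ?_⟩
    · exact σ.symm_apply_eq.2 h1.symm
    · refine σ.symm_apply_eq.2 ?_
      rw [h2]
      simp [LinearEquiv.coe_inv]

/-- `V` is linearly spanned by the vectors `u⁽¹⁾_{n₁} ⋯ u⁽ʳ⁾_{nᵣ} 1` with `r ≥ 0`,
`u⁽ⁱ⁾ ∈ U` and `nᵢ ∈ ℤ`. -/
def IsGenerating (U : Set V) : Prop :=
  Submodule.span ℂ {w : V | ∃ l : List (V × ℤ), (∀ q ∈ l, q.1 ∈ U) ∧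
    w = l.foldr (fun q y => A.mode q.1 q.2 y) A.vac} = ⊤

/-- `T`-type: for all `u, v` there are finitely many `u⁽ⁱ⁾, v⁽ⁱ⁾ ∈ V`, `fᵢ ∈ ℂ(x)` and `k ≥ 0`
with `(x₁ - x₂)ᵏ Y(u,x₁) Y(v,x₂)
  = (x₁ - x₂)ᵏ ∑ᵢ ι_{x₂,x₁}(fᵢ(e^{x₁-x₂})) Y(v⁽ⁱ⁾,x₂) Y(u⁽ⁱ⁾,x₁)`. -/
def IsTType : Prop :=
  ∀ u v : V, ∃ (r : ℕ) (u' v' : Fin r → V) (f : Fin r → RatFunc ℂ) (k : ℕ),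
    ∀ w : V,
      mulSeries (subPow k) (fieldMul (A.Y u) (A.Y v) w) =
        mulSeries (subPow k)
          (∑ i, mulSeries (iotaExp (f i)) (fieldMulRev (A.Y (v' i)) (A.Y (u' i)) w))

end WeakQVA

/-! ### `φ`-coordinated quasi modules -/

/-- A `φ`-coordinated quasi `V`-module structure on the vector space `W`. -/
structure PhiQuasiModule {V : Type u} [AddCommGroup V] [Module ℂ V] (A : WeakQVA V)
    (W : Type v) [AddCommGroup W] [Module ℂ W] where
  /-- the vertex operator map `Y_W` -/
  YW : V →ₗ[ℂ] FieldOn W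
  /-- `Y_W(1, x)` is the identity of `W` -/
  vac_act : ∀ w : W, YW A.vac w = HahnSeries.single 0 w
  /-- for `u, v ∈ V` there is a nonzero polynomial `p` such that
  `p(x₁/x₂) Y_W(u,x₁) Y_W(v,x₂) ∈ Hom(W, W((x₁,x₂)))` and
  `p(e^z) Y_W(Y(u,z)v, x₂) = (p(x₁/x₂) Y_W(u,x₁) Y_W(v,x₂))|_{x₁ = x₂ e^z}` -/
  assoc : ∀ u v : V, ∃ p : Polynomial ℂ, p ≠ 0 ∧
    IsCompatibleWith p (YW u) (YW v) ∧
    ∀ w : W,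
      mulSeries (polyExp p) (fun e => (YW ((A.Y u v).coeff e.1) w).coeff e.2) =
        substExp (mulSeries (polyRatio p) (fieldMul (YW u) (YW v) w))

/-- The `φ`-coordinated quasi module is `G`-covariant, for a group `G` acting on `V` by
automorphisms (through `ρ`) and a linear character `χ : G → ℂˣ`. -/
def PhiQuasiModule.IsCovariant {V : Type u} [AddCommGroup V] [Module ℂ V] {A : WeakQVA V}
    {W : Type v} [AddCommGroup W] [Module ℂ W] (M : PhiQuasiModule A W)
    {G : Type*} [Group G] (ρ : G →* A.Aut) (χ : G →* ℂˣ) : Prop :=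
  (∀ (g : G) (v : V), M.YW ((ρ g : V ≃ₗ[ℂ] V) v) = (M.YW v).scale (χ g)) ∧
  ∀ u v : V, ∃ p : Polynomial ℂ, ZerosIn χ.range p ∧ IsCompatibleWith p (M.YW u) (M.YW v)

end

end PhiQVA

/-!
The covariance relation and the existence of good polynomials are both proved by induction on
words `u⁽¹⁾_{n₁} ⋯ u⁽ʳ⁾_{nᵣ} 1` in the generators. The step for `uₙ v` rests on one formula.
Associativity says `p(e^z) Y_W(Y(u,z)v, x) = (p(x₁/x) Y_W(u,x₁) Y_W(v,x))|_{x₁ = x e^z}`. Since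
`p(e^z) ≠ 0`, one can solve for the coefficient of `zᵏ`, and it is a sum along antidiagonals of the
coefficients of `F = p(x₁/x) Y_W(u,x₁) Y_W(v,x)`, the coefficient of `x₁ᵐ x^(j-m)` being weighted by
`c(m)` for a polynomial `c` (`PhiQuasiModule.exists_coeff_eq_finsum`).

*Covariance.* If `Y_W(u',x) = Y_W(u,cx)` and `Y_W(v',x) = Y_W(v,cx)`, both associativity relations
are multiplied up to a common polynomial. The substitution `x₁ = x e^z` commutes with rescaling both
variables, so the two sides agree after cancelling nonzero power series in `z`
(`PhiQuasiModule.YW_scale_coeff`).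

*Zeros.* The product `p(x/z) a(x) b(z) w` is always bounded below in `z`, so only boundedness below
in `x` is at stake. Two facts carry the argument.

* `polShift_pow_weightedDiag_mem`: suppose that after multiplication by `p(x/y)` all weighted
  antidiagonal sums merging `y` into `z` become bounded. Then a power of `p(x/z)` makes each
  weighted sum itself bounded. Indeed, merging turns `p(x/y)` into `p(x/z)` up to terms whose
  weights have smaller degree, and one inducts on the degree. Thus passing from `u` and `v` to
  `uₙ v` introduces no new zeros.
* `IsQuasiTrigLocal.exists_mem_bddBelow`: by locality `a(x) b(y)` may be replaced by the terms
  `ι(f(y/x)) b'(y) a'(x)`, and `ι(f(y/x))` is bounded below in `x`. So boundedness in `x` of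
  `a'(x) ω` for all generating `a'` passes to `a(x) b(y) ω`.

Together they show that `a(x) Y_W(v,y) Y_W(v₂,z) w` is bounded below in `x`, after multiplication by
`p(x/y) p(x/z)`, for every generating field `a` and all `v, v₂`
(`PhiQuasiModule.isTripleBdd`). A second induction, now on the left factor, merges `a` with `v` and
gives the claim for all pairs (`PhiQuasiModule.isPairBdd`).
-/

namespace PhiQVA

open Polynomial

/-! ### Multiplication by polynomials in a monomial -/

section Shift

variable {Γ : Type*} [AddCommGroup Γ] {W : Type*} [AddCommGroup W] [Module ℂ W]

/-- Multiplication of a series by the monomial with exponent `γ`. -/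
def shift (γ : Γ) : Module.End ℂ (Γ → W) := LinearMap.funLeft ℂ W (fun e => e - γ)

theorem shift_apply (γ : Γ) (f : Γ → W) (e : Γ) : shift γ f e = f (e - γ) := rfl

theorem shift_pow_apply (γ : Γ) (k : ℕ) (f : Γ → W) (e : Γ) :
    (shift γ ^ k) f e = f (e - k • γ) := by
  induction k generalizing e with
  | zero => simp
  | succ k ih =>
    rw [pow_succ', Module.End.mul_apply, shift_apply, ih, succ_nsmul]
    congr 1
    abel

/-- Multiplication of a series by `p(x^γ)`, where `x^γ` is the monomial with exponent `γ`.
For example `γ = (1, -1)` gives multiplication by `p(x₁/x₂)`. -/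
noncomputable def polShift (p : ℂ[X]) (γ : Γ) : Module.End ℂ (Γ → W) := aeval (shift γ) p

theorem polShift_eq_sum (p : ℂ[X]) (γ : Γ) (f : Γ → W) :
    polShift p γ f =
      ∑ k ∈ Finset.range (p.natDegree + 1), p.coeff k • (shift γ ^ k) f := by
  simp [polShift, aeval_eq_sum_range, LinearMap.sum_apply]

theorem polShift_apply (p : ℂ[X]) (γ : Γ) (f : Γ → W) (e : Γ) :
    polShift p γ f e =
      ∑ k ∈ Finset.range (p.natDegree + 1), p.coeff k • f (e - k • γ) := by
  simp [polShift_eq_sum, shift_pow_apply]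

theorem polShift_mul (p q : ℂ[X]) (γ : Γ) (f : Γ → W) :
    polShift (p * q) γ f = polShift p γ (polShift q γ f) := by
  simp [polShift]

theorem polShift_one (γ : Γ) (f : Γ → W) : polShift 1 γ f = f := by
  simp [polShift]

theorem polShift_comm (p q : ℂ[X]) (γ δ : Γ) (f : Γ → W) :
    polShift p γ (polShift q δ f) = polShift q δ (polShift p γ f) := by
  ext e
  simp only [polShift_apply, Finset.smul_sum]
  rw [Finset.sum_comm]
  refine Finset.sum_congr rfl fun i _ => Finset.sum_congr rfl fun j _ => ?_
  rw [smul_comm, sub_right_comm]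

theorem shift_eq_polShift_X (γ : Γ) (f : Γ → W) : shift γ f = polShift X γ f := by
  simp [polShift]

theorem map_polShift {Γ' : Type*} [AddCommGroup Γ'] {W' : Type*} [AddCommGroup W'] [Module ℂ W']
    (Φ : (Γ → W) →ₗ[ℂ] (Γ' → W')) {γ : Γ} {γ' : Γ'}
    (h : ∀ f, Φ (shift γ f) = shift γ' (Φ f)) (p : ℂ[X]) (f : Γ → W) :
    Φ (polShift p γ f) = polShift p γ' (Φ f) := by
  have hk : ∀ (k : ℕ) f, Φ ((shift γ ^ k) f) = (shift γ' ^ k) (Φ f) := by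
    intro k
    induction k with
    | zero => simp
    | succ k ih =>
      intro f
      rw [pow_succ, Module.End.mul_apply, ih, h, pow_succ, Module.End.mul_apply]
  simp [polShift_eq_sum, hk]

theorem polShift_mem (B : Submodule ℂ (Γ → W)) {γ : Γ} (hB : ∀ f ∈ B, shift γ f ∈ B)
    (p : ℂ[X]) {f : Γ → W} (hf : f ∈ B) : polShift p γ f ∈ B := by
  rw [polShift_eq_sum]
  refine B.sum_mem fun k hk => B.smul_mem _ ?_
  clear hk
  induction k with
  | zero => simpa
  | succ k ih =>
    rw [pow_succ', Module.End.mul_apply]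
    exact hB _ ih

/-- The series whose exponents, measured by `π`, are bounded below. -/
def bddBelow (π : Γ →+ ℤ) : Submodule ℂ (Γ → W) where
  carrier := {f | ∃ N : ℤ, ∀ e, π e < N → f e = 0}
  zero_mem' := ⟨0, fun _ _ => rfl⟩
  add_mem' := by
    rintro f g ⟨N, hN⟩ ⟨M, hM⟩
    refine ⟨min N M, fun e he => ?_⟩
    rw [Pi.add_apply, hN e (by omega), hM e (by omega), add_zero]
  smul_mem' := by
    rintro c f ⟨N, hN⟩
    exact ⟨N, fun e he => by rw [Pi.smul_apply, hN e he, smul_zero]⟩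

theorem polShift_mem_bddBelow (π : Γ →+ ℤ) (p : ℂ[X]) (γ : Γ) {f : Γ → W}
    (hf : f ∈ bddBelow π) : polShift p γ f ∈ bddBelow π := by
  refine polShift_mem _ ?_ p hf
  rintro f ⟨N, hN⟩
  refine ⟨N + π γ, fun e he => hN _ ?_⟩
  rw [map_sub]
  omega

/-- The series whose exponents, measured by `π`, are bounded below on each fibre of `τ`, with a
bound that may depend on the fibre. -/
def bddBelowOnFibres {T : Type*} (W : Type*) [AddCommGroup W] [Module ℂ W] [AddCommGroup T]
    (π : Γ →+ ℤ) (τ : Γ →+ T) : Submodule ℂ (Γ → W) where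
  carrier := {f | ∀ t, ∃ N : ℤ, ∀ e, τ e = t → π e < N → f e = 0}
  zero_mem' := fun _ => ⟨0, fun _ _ _ => rfl⟩
  add_mem' := by
    intro f g hf hg t
    obtain ⟨N, hN⟩ := hf t
    obtain ⟨M, hM⟩ := hg t
    refine ⟨min N M, fun e ht he => ?_⟩
    rw [Pi.add_apply, hN e ht (by omega), hM e ht (by omega), add_zero]
  smul_mem' := by
    intro c f hf t
    obtain ⟨N, hN⟩ := hf t
    exact ⟨N, fun e ht he => by rw [Pi.smul_apply, hN e ht he, smul_zero]⟩

theorem polShift_mem_bddBelowOnFibres {T : Type*} [AddCommGroup T] (π : Γ →+ ℤ) (τ : Γ →+ T)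
    (p : ℂ[X]) (γ : Γ) {f : Γ → W} (hf : f ∈ bddBelowOnFibres W π τ) :
    polShift p γ f ∈ bddBelowOnFibres W π τ := by
  refine polShift_mem _ ?_ p hf
  intro f hf t
  obtain ⟨N, hN⟩ := hf (t - τ γ)
  refine ⟨N + π γ, fun e ht he => hN _ ?_ ?_⟩
  · rw [map_sub, ht]
  · rw [map_sub]
    omega

/-- A polynomial with nonzero constant term can be cancelled, if along each ray `e - k • γ` the
coefficients eventually vanish: it is then invertible as a power series in the monomial `x^γ`. -/
theorem mem_bddBelow_of_polShift (π : Γ →+ ℤ) (p : ℂ[X]) (hp : p.coeff 0 ≠ 0) (γ : Γ)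
    (hγ : 0 ≤ π γ) {f : Γ → W} (hf : polShift p γ f ∈ bddBelow π)
    (h : ∀ e, ∃ K : ℕ, ∀ k : ℕ, K ≤ k → f (e - k • γ) = 0) : f ∈ bddBelow π := by
  obtain ⟨N, hN⟩ := hf
  refine ⟨N, fun e he => ?_⟩
  obtain ⟨K, hK⟩ := h e
  -- descending induction on the distance to the vanishing range
  have key : ∀ d k : ℕ, K ≤ k + d → f (e - k • γ) = 0 := by
    intro d
    induction d with
    | zero => exact fun k hk => hK k hk
    | succ d ih =>
      intro k hk
      have h0 := hN (e - k • γ) (by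
        rw [map_sub, map_nsmul, nsmul_eq_mul]
        have := mul_nonneg (Int.natCast_nonneg k) hγ
        omega)
      rw [polShift_apply, Finset.sum_eq_single 0] at h0
      · simpa [hp] using h0
      · intro b _ hb
        rw [sub_sub, ← add_nsmul, ih (k + b) (by omega), smul_zero]
      · simp
  simpa using key K 0 (by omega)

theorem mulSeries_polyRatio (p : ℂ[X]) (S : ℤ × ℤ → W) :
    mulSeries (polyRatio p) S = polShift p (1, -1) S := by
  ext m
  have hinj : Function.Injective fun k : ℕ => ((k : ℤ), -(k : ℤ)) := fun a b h => by
    simpa using h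
  rw [polShift_apply, mulSeries, finsum_eq_sum_of_support_subset _ (s :=
    (Finset.range (p.natDegree + 1)).image fun k : ℕ => ((k : ℤ), -(k : ℤ))),
    Finset.sum_image hinj.injOn]
  · refine Finset.sum_congr rfl fun k _ => ?_
    simp [polyRatio]
  · intro i hi
    have hi' : polyRatio p i ≠ 0 := fun h => hi (by simp [h])
    unfold polyRatio at hi'
    split_ifs at hi' with h
    · simp only [Finset.coe_image, Set.mem_image, Finset.mem_coe, Finset.mem_range]
      refine ⟨i.1.toNat, Nat.lt_succ_of_le (le_natDegree_of_ne_zero hi'), ?_⟩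
      ext <;> simp <;> omega
    · exact absurd rfl hi'

end Shift

/-! ### Weighted sums of coefficients along a direction -/

section Diag

variable {Γ K : Type*} [AddCommGroup Γ] [AddCommGroup K] {W : Type*} [AddCommGroup W] [Module ℂ W]

/-- The coefficients of `E` are summed along the lines `σ k + ℤ δ`, the point `σ k + m • δ` with
weight `c(m)`. With `σ j = (0, j)` and `δ = (1, -1)` and `c = mⁿ / n!`, this is the coefficient of
`zⁿ` in the substitution `x₁ = x₂ e^z`. -/
noncomputable def weightedDiag (σ : K →+ Γ) (δ : Γ) (c : ℂ[X]) (E : Γ → W) : K → W :=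
  fun k => ∑ᶠ m : ℤ, c.eval (m : ℂ) • E (σ k + m • δ)

/-- The series with finitely many nonzero coefficients on each line `σ k + ℤ δ`, for which
`weightedDiag` has no junk values. -/
def fibreFinite (W : Type*) [AddCommGroup W] [Module ℂ W] (σ : K →+ Γ) (δ : Γ) :
    Submodule ℂ (Γ → W) where
  carrier := {E | ∀ k, (Function.support fun m : ℤ => E (σ k + m • δ)).Finite}
  zero_mem' := fun k => by simp
  add_mem' := fun {f g} hf hg k => by
    refine ((hf k).union (hg k)).subset (Function.support_add _ _)
  smul_mem' := fun c f hf k => by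
    refine (hf k).subset (Function.support_const_smul_subset c _)

variable {σ : K →+ Γ} {δ : Γ}

theorem finite_support_weightedDiag {E : Γ → W} (hE : E ∈ fibreFinite W σ δ) (c : ℂ[X]) (k : K) :
    (Function.support fun m : ℤ => c.eval (m : ℂ) • E (σ k + m • δ)).Finite :=
  (hE k).subset (Function.support_smul_subset_right _ _)

/-- `weightedDiag σ δ c E` as a linear function of the weight `c`. -/
noncomputable def weightedDiagLinear {E : Γ → W} (hE : E ∈ fibreFinite W σ δ) :
    ℂ[X] →ₗ[ℂ] (K → W) where
  toFun c := weightedDiag σ δ c E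
  map_add' c d := by
    ext k
    simp only [weightedDiag, Pi.add_apply, eval_add, add_smul]
    exact finsum_add_distrib (finite_support_weightedDiag hE c k)
      (finite_support_weightedDiag hE d k)
  map_smul' r c := by
    ext k
    simp only [weightedDiag, Pi.smul_apply, eval_smul, smul_eq_mul, mul_smul, RingHom.id_apply]
    exact (smul_finsum r _).symm

theorem weightedDiag_shift (κ : K) (r : ℤ) (c : ℂ[X]) (E : Γ → W) :
    weightedDiag σ δ c (shift (σ κ + r • δ) E) =
      shift κ (weightedDiag σ δ (taylor (r : ℂ) c) E) := by
  ext k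
  simp only [weightedDiag, shift_apply]
  refine (finsum_comp_equiv (Equiv.addRight r)).symm.trans (finsum_congr fun m => ?_)
  simp only [Equiv.coe_addRight, taylor_eval, map_sub, add_smul, Int.cast_add]
  congr 2
  abel

theorem shift_mem_fibreFinite (κ : K) (r : ℤ) {E : Γ → W} (hE : E ∈ fibreFinite W σ δ) :
    shift (σ κ + r • δ) E ∈ fibreFinite W σ δ := by
  intro k
  refine ((hE (k - κ)).preimage (f := fun m : ℤ => m - r)
    (fun a _ b _ h => by simpa using h)).subset ?_
  intro m hm
  simp only [Set.mem_preimage, Function.mem_support, shift_apply] at hm ⊢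
  convert hm using 2
  rw [map_sub, sub_smul]
  abel

/-- Since `δ` is contracted, multiplication by `p(x^(σ κ + r δ))` becomes multiplication by
`p(x^κ)`, except that the weight in the `k`-th term is translated by `k r`. -/
theorem weightedDiag_polShift (κ : K) (r : ℤ) (p c : ℂ[X]) {E : Γ → W}
    (hE : E ∈ fibreFinite W σ δ) :
    weightedDiag σ δ c (polShift p (σ κ + r • δ) E) =
      ∑ k ∈ Finset.range (p.natDegree + 1),
        p.coeff k • (shift κ ^ k) (weightedDiag σ δ (taylor ((k : ℂ) * r) c) E) := by
  have hpow : ∀ (k : ℕ) (c : ℂ[X]), weightedDiag σ δ c ((shift (σ κ + r • δ) ^ k) E) =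
      (shift κ ^ k) (weightedDiag σ δ (taylor ((k : ℂ) * r) c) E) := by
    intro k
    induction k with
    | zero => simp
    | succ k ih =>
      intro c
      rw [pow_succ', Module.End.mul_apply, weightedDiag_shift, ih, taylor_taylor, pow_succ',
        Module.End.mul_apply]
      congr 4
      push_cast
      rw [add_one_mul]
  have hmem : ∀ k : ℕ, (shift (σ κ + r • δ) ^ k) E ∈ fibreFinite W σ δ := by
    intro k
    induction k with
    | zero => simpa
    | succ k ih =>
      rw [pow_succ', Module.End.mul_apply]
      exact shift_mem_fibreFinite κ r ih
  simp_rw [← hpow]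
  ext k
  simp only [weightedDiag, polShift_eq_sum, Finset.sum_apply, Pi.smul_apply, Finset.smul_sum]
  rw [finsum_sum_comm]
  · refine Finset.sum_congr rfl fun i _ => ?_
    rw [smul_finsum]
    exact finsum_congr fun m => smul_comm _ _ _
  · intro i _
    refine ((hmem i k)).subset ?_
    intro m hm h
    exact hm (by simp only [h, smul_zero])

theorem weightedDiag_polShift_map (κ : K) (p c : ℂ[X]) {E : Γ → W} (hE : E ∈ fibreFinite W σ δ) :
    weightedDiag σ δ c (polShift p (σ κ) E) = polShift p κ (weightedDiag σ δ c E) := by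
  have := weightedDiag_polShift κ 0 p c hE
  simpa [polShift_eq_sum] using this

theorem polShift_mem_fibreFinite (κ : K) (r : ℤ) (p : ℂ[X]) {E : Γ → W}
    (hE : E ∈ fibreFinite W σ δ) : polShift p (σ κ + r • δ) E ∈ fibreFinite W σ δ :=
  polShift_mem _ (fun _ hf => shift_mem_fibreFinite κ r hf) p hE

/-- If every weighted sum of `p(x^(σ κ + r δ)) E` lies in `B`, then a power of `p(x^κ)` brings
every weighted sum of `E` itself into `B`. Translating a weight changes it by terms of lower degree,
so the exponent `deg c + 1` suffices. -/
theorem polShift_pow_weightedDiag_mem (B : Submodule ℂ (K → W)) (κ : K)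
    (hB : ∀ f ∈ B, shift κ f ∈ B) (r : ℤ) (p : ℂ[X]) {E : Γ → W} (hE : E ∈ fibreFinite W σ δ)
    (h : ∀ c, weightedDiag σ δ c (polShift p (σ κ + r • δ) E) ∈ B) (c : ℂ[X]) :
    polShift (p ^ (c.natDegree + 1)) κ (weightedDiag σ δ c E) ∈ B := by
  suffices H : ∀ (n : ℕ) (c : ℂ[X]), c.degree < n →
      polShift (p ^ n) κ (weightedDiag σ δ c E) ∈ B from
    H _ c (degree_le_natDegree.trans_lt (by exact_mod_cast Nat.lt_succ_self _))
  intro n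
  induction n with
  | zero =>
    intro c hc
    have : c = 0 := by simpa using hc
    subst this
    have h0 : weightedDiag σ δ 0 E = 0 := (weightedDiagLinear hE).map_zero
    simp [h0]
  | succ n ih =>
    intro c hc
    rcases eq_or_ne c 0 with rfl | hc0
    · have h0 : weightedDiag σ δ 0 E = 0 := (weightedDiagLinear hE).map_zero
      simp [h0]
    have h1 : polShift p κ (weightedDiag σ δ c E) =
        weightedDiag σ δ c (polShift p (σ κ + r • δ) E) +
        ∑ k ∈ Finset.range (p.natDegree + 1), p.coeff k •
          (shift κ ^ k) (weightedDiag σ δ (c - taylor ((k : ℂ) * r) c) E) := by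
      have h2 : ∀ k : ℕ, weightedDiag σ δ (c - taylor ((k : ℂ) * r) c) E =
          weightedDiag σ δ c E - weightedDiag σ δ (taylor ((k : ℂ) * r) c) E :=
        fun k => (weightedDiagLinear hE).map_sub _ _
      rw [weightedDiag_polShift κ r p c hE, polShift_eq_sum, ← Finset.sum_add_distrib]
      refine Finset.sum_congr rfl fun k _ => ?_
      rw [h2, map_sub, smul_sub]
      abel
    rw [pow_succ, polShift_mul, h1, map_add]
    refine B.add_mem (polShift_mem B hB _ (h c)) ?_
    rw [map_sum]
    refine B.sum_mem fun k _ => ?_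
    rw [map_smul]
    refine B.smul_mem _ ?_
    have h3 := polShift_comm (p ^ n) (X ^ k) κ κ (weightedDiag σ δ (c - taylor ((k : ℂ) * r) c) E)
    have h4 : ∀ f : K → W, polShift (X ^ k) κ f = (shift κ ^ k) f := fun f => by simp [polShift]
    rw [h4, h4] at h3
    rw [h3, ← h4]
    refine polShift_mem B hB _ (ih _ ?_)
    have h5 := degree_sub_lt_left (degree_taylor c ((k : ℂ) * r)).symm hc0
      (leadingCoeff_taylor (r := (k : ℂ) * r) (f := c)).symm
    refine h5.trans_le ?_
    rw [degree_eq_natDegree hc0] at hc ⊢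
    exact_mod_cast Nat.lt_succ_iff.1 (by exact_mod_cast hc)

end Diag

/-! ### Division by `p(e^z)` and the substitution `x₁ = x₂ e^z` -/

section Act

variable {W : Type*} [AddCommGroup W] [Module ℂ W]

/-- The product of a power series `H(z)` and a vector valued series `G(z)`; it is meaningful if
`G` is lower truncated. -/
noncomputable def powerMul (H : PowerSeries ℂ) (G : ℤ → W) : ℤ → W :=
  fun k => ∑ᶠ i : ℕ, PowerSeries.coeff i H • G (k - i)

theorem powerMul_eq_sum (H : PowerSeries ℂ) {G : ℤ → W} {N : ℤ} (hG : ∀ k < N, G k = 0)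
    (k : ℤ) (L : ℕ) (hL : k - N < L) :
    powerMul H G k = ∑ i ∈ Finset.range L, PowerSeries.coeff i H • G (k - i) := by
  refine finsum_eq_sum_of_support_subset _ fun i hi => ?_
  by_contra h
  refine hi ?_
  simp only [Finset.coe_range, Set.mem_Iio, not_lt] at h
  simp only
  rw [hG _ (by omega), smul_zero]

theorem powerMul_eq_zero (H : PowerSeries ℂ) {G : ℤ → W} {N : ℤ} (hG : ∀ k < N, G k = 0)
    (k : ℤ) (hk : k < N) : powerMul H G k = 0 := by
  rw [powerMul_eq_sum H hG k 0 (by simpa using hk)]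
  simp

theorem powerMul_comm (P Q : PowerSeries ℂ) {G : ℤ → W} {N : ℤ} (hG : ∀ k < N, G k = 0) :
    powerMul P (powerMul Q G) = powerMul Q (powerMul P G) := by
  ext k
  have hL : k - N < ((k - N).toNat + 1 : ℕ) := by omega
  rw [powerMul_eq_sum P (powerMul_eq_zero Q hG) k _ hL,
    powerMul_eq_sum Q (powerMul_eq_zero P hG) k _ hL]
  have h : ∀ (H : PowerSeries ℂ) (i : ℕ), powerMul H G (k - i) =
      ∑ j ∈ Finset.range ((k - N).toNat + 1), PowerSeries.coeff j H • G (k - i - j) :=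
    fun H i => powerMul_eq_sum H hG _ _ (by omega)
  simp only [h, Finset.smul_sum]
  rw [Finset.sum_comm]
  refine Finset.sum_congr rfl fun i _ => Finset.sum_congr rfl fun j _ => ?_
  rw [smul_comm, sub_right_comm]

/-- The polynomial `mᵏ / k!` in `m`, that is, the coefficient of `zᵏ` in `e^{mz}`; zero for
`k < 0`. -/
noncomputable def expWeight (k : ℤ) : ℂ[X] :=
  if 0 ≤ k then C (1 / (k.toNat.factorial : ℂ)) * X ^ k.toNat else 0

/-- If `H ≠ 0` and the coefficients of `H(z) G(z)` are those of `D(e^{mz})`, for a linear map `D`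
on polynomials in `m`, then each coefficient of `G` is the value of `D` at a polynomial. It depends
only on `H`, the exponent and the truncation bound `N`, and is found by solving recursively from the
lowest nonzero coefficient of `H`. -/
theorem exists_weight_of_powerMul (H : PowerSeries ℂ) (hH : H ≠ 0) (N n : ℤ) :
    ∃ c : ℂ[X], ∀ (G : ℤ → W) (D : ℂ[X] →ₗ[ℂ] W), (∀ k < N, G k = 0) →
      (∀ k, powerMul H G k = D (expWeight k)) → G n = D c := by
  obtain ⟨s, hs, hs'⟩ : ∃ s, PowerSeries.coeff s H ≠ 0 ∧
      ∀ i < s, PowerSeries.coeff i H = 0 := by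
    have := PowerSeries.exists_coeff_ne_zero_iff_ne_zero.2 hH
    classical
    exact ⟨Nat.find this, Nat.find_spec this, fun i hi => not_not.1 (Nat.find_min this hi)⟩
  suffices h : ∀ (d : ℕ) (n : ℤ), n < N + d → ∃ c : ℂ[X], ∀ (G : ℤ → W) (D : ℂ[X] →ₗ[ℂ] W),
      (∀ k < N, G k = 0) → (∀ k, powerMul H G k = D (expWeight k)) → G n = D c from
    h ((n - N).toNat + 1) n (by omega)
  intro d
  induction d with
  | zero => exact fun n hn => ⟨0, fun G D hG _ => by rw [hG n (by simpa using hn), map_zero]⟩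
  | succ d ih =>
    intro n hn
    choose! c hc using ih
    refine ⟨(PowerSeries.coeff s H)⁻¹ • (expWeight (n + s) -
      ∑ i ∈ Finset.range d, PowerSeries.coeff (s + 1 + i) H • c (n - 1 - i)), ?_⟩
    intro G D hG hD
    have h1 := hD (n + s)
    rw [powerMul_eq_sum H hG _ (s + (1 + d)) (by push_cast at hn ⊢; omega),
      Finset.sum_range_add, Finset.sum_eq_zero (fun i hi => by
        rw [hs' i (Finset.mem_range.1 hi), zero_smul]), zero_add, Finset.sum_range_add] at h1
    simp only [Finset.range_one, Finset.sum_singleton, add_zero] at h1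
    have h2 : ∀ i ∈ Finset.range d, PowerSeries.coeff (s + (1 + i)) H •
        G (n + s - ((s + (1 + i) : ℕ) : ℤ)) =
        D (PowerSeries.coeff (s + 1 + i) H • c (n - 1 - i)) := by
      intro i _
      rw [map_smul, ← hc (n - 1 - i) (by push_cast at hn; omega) G D hG hD, add_assoc]
      congr 2
      push_cast
      ring
    rw [Finset.sum_congr rfl h2, ← map_sum, ← eq_sub_iff_add_eq, ← map_sub] at h1
    rw [map_smul, ← h1, add_sub_cancel_right, inv_smul_smul₀ hs]

theorem eq_zero_of_powerMul_eq_zero {H : PowerSeries ℂ} (hH : H ≠ 0) {G : ℤ → W} {N : ℤ}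
    (hG : ∀ k < N, G k = 0) (h : powerMul H G = 0) : G = 0 := by
  ext n
  obtain ⟨c, hc⟩ := exists_weight_of_powerMul (W := W) H hH N n
  simpa using hc G 0 hG (fun k => by simp [h])

theorem coeff_aeval_exp (p : ℂ[X]) (i : ℕ) :
    PowerSeries.coeff i (aeval (PowerSeries.exp ℂ) p) =
      ∑ a ∈ Finset.range (p.natDegree + 1), p.coeff a * ((a : ℂ) ^ i / (i.factorial : ℂ)) := by
  rw [aeval_eq_sum_range, map_sum]
  refine Finset.sum_congr rfl fun a _ => ?_
  rw [PowerSeries.exp_pow_eq_rescale_exp, PowerSeries.coeff_smul, PowerSeries.coeff_rescale,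
    PowerSeries.coeff_exp]
  simp [div_eq_mul_inv]

/-- `p(e^z) ≠ 0` for `p ≠ 0`: if `∑ₐ pₐ aⁱ = 0` for all `i`, then `∑ₐ pₐ g(a) = 0` for all
polynomials `g`. -/
theorem aeval_exp_ne_zero {p : ℂ[X]} (hp : p ≠ 0) : aeval (PowerSeries.exp ℂ) p ≠ 0 := by
  intro h0
  have h1 : ∀ i : ℕ, ∑ a ∈ Finset.range (p.natDegree + 1), p.coeff a * (a : ℂ) ^ i = 0 := by
    intro i
    have := coeff_aeval_exp p i
    rw [h0, map_zero] at this
    simp only [← mul_div_assoc, ← Finset.sum_div] at this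
    have h2 := this.symm
    rwa [div_eq_zero_iff, or_iff_left (by exact_mod_cast i.factorial_ne_zero)] at h2
  have h2 : ∀ g : ℂ[X], ∑ a ∈ Finset.range (p.natDegree + 1), p.coeff a * g.eval (a : ℂ) = 0 := by
    intro g
    simp only [eval_eq_sum_range, Finset.mul_sum]
    rw [Finset.sum_comm]
    refine Finset.sum_eq_zero fun i _ => ?_
    have := congrArg (g.coeff i * ·) (h1 i)
    simp only [Finset.mul_sum, mul_zero] at this
    rw [← this]
    exact Finset.sum_congr rfl fun a _ => by ring
  -- test against the polynomial vanishing at all the other exponents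
  have h3 := h2 (∏ b ∈ (Finset.range (p.natDegree + 1)).erase p.natDegree, (X - C (b : ℂ)))
  rw [Finset.sum_eq_single p.natDegree] at h3
  · rw [eval_prod, mul_eq_zero, Finset.prod_eq_zero_iff] at h3
    rcases h3 with h3 | ⟨b, hb, h3⟩
    · exact hp (leadingCoeff_eq_zero.1 h3)
    · refine (Finset.mem_erase.1 hb).1 ?_
      simp only [eval_sub, eval_X, eval_C, sub_eq_zero] at h3
      exact_mod_cast h3.symm
  · intro a ha hne
    rw [eval_prod, Finset.prod_eq_zero (Finset.mem_erase.2 ⟨hne, ha⟩) (by simp), mul_zero]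
  · simp

theorem mulSeries_polyExp (p : ℂ[X]) (S : ℤ × ℤ → W) (k j : ℤ) :
    mulSeries (polyExp p) S (k, j) =
      powerMul (aeval (PowerSeries.exp ℂ) p) (fun k => S (k, j)) k := by
  have hinj : Function.Injective fun i : ℕ => ((i : ℤ), (0 : ℤ)) := fun a b h => by
    simpa using h
  rw [mulSeries, powerMul, ← finsum_mem_univ, finsum_mem_inter_support_eq'
    (t := Set.range fun i : ℕ => ((i : ℤ), (0 : ℤ))), finsum_mem_range hinj]
  · simp [polyExp]
  · intro e he
    simp only [Set.mem_univ, Set.mem_range, true_iff]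
    have he' : polyExp p e ≠ 0 := fun h => he (by simp [h])
    unfold polyExp at he'
    split_ifs at he' with h
    · exact ⟨e.1.toNat, by ext <;> simp <;> omega⟩
    · exact absurd rfl he'

theorem isLaurent_iff (S : ℤ × ℤ → W) : IsLaurent S ↔
    S ∈ bddBelow (W := W) (AddMonoidHom.fst ℤ ℤ) ∧
      S ∈ bddBelow (W := W) (AddMonoidHom.snd ℤ ℤ) := by
  constructor
  · rintro ⟨N, hN⟩
    refine ⟨⟨N, fun e he => ?_⟩, ⟨N, fun e he => ?_⟩⟩
    · by_contra h
      exact absurd (hN e.1 e.2 h).1 (not_le.2 he)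
    · by_contra h
      exact absurd (hN e.1 e.2 h).2 (not_le.2 he)
  · rintro ⟨⟨N, hN⟩, ⟨M, hM⟩⟩
    refine ⟨min N M, fun m n h => ⟨?_, ?_⟩⟩
    · by_contra h'
      exact h (hN (m, n) (by simp at h' ⊢; omega))
    · by_contra h'
      exact h (hM (m, n) (by simp at h' ⊢; omega))

theorem IsLaurent.polShift {S : ℤ × ℤ → W} (hS : IsLaurent S) (p : ℂ[X]) (γ : ℤ × ℤ) :
    IsLaurent (polShift p γ S) := by
  rw [isLaurent_iff] at hS ⊢
  exact ⟨polShift_mem_bddBelow _ _ _ hS.1, polShift_mem_bddBelow _ _ _ hS.2⟩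

theorem IsLaurent.finite_antidiagonal {W : Type*} [Zero W] {S : ℤ × ℤ → W} (hS : IsLaurent S)
    (j : ℤ) : (Function.support fun m : ℤ => S (m, j - m)).Finite := by
  obtain ⟨N, hN⟩ := hS
  refine (Set.finite_Icc N (j - N)).subset fun m hm => ?_
  have := hN _ _ hm
  exact ⟨this.1, by omega⟩

theorem IsLaurent.mem_fibreFinite {S : ℤ × ℤ → W} (hS : IsLaurent S) :
    S ∈ fibreFinite W (AddMonoidHom.inr ℤ ℤ) (1, -1) := by
  intro j
  simpa [sub_eq_add_neg] using hS.finite_antidiagonal j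

theorem weightedDiag_antidiagonal (S : ℤ × ℤ → W) (c : ℂ[X]) (j : ℤ) :
    weightedDiag (AddMonoidHom.inr ℤ ℤ) (1, -1) c S j =
      ∑ᶠ m : ℤ, c.eval (m : ℂ) • S (m, j - m) := by
  simp [weightedDiag, sub_eq_add_neg]

theorem substExp_eq_weightedDiag (S : ℤ × ℤ → W) (k j : ℤ) :
    substExp S (k, j) = weightedDiag (AddMonoidHom.inr ℤ ℤ) (1, -1) (expWeight k) S j := by
  rw [weightedDiag_antidiagonal, substExp, expWeight]
  split_ifs with h
  · refine finsum_congr fun m => ?_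
    simp [div_eq_inv_mul]
  · simp

/-- The identity `∑ₐ qₐ e^{(m+a)z} = q(e^z) e^{mz}`, coefficientwise in `z`. -/
theorem sum_taylor_expWeight (q : ℂ[X]) (k : ℕ) :
    ∑ a ∈ Finset.range (q.natDegree + 1), q.coeff a • taylor (a : ℂ) (expWeight k) =
      ∑ i ∈ Finset.range (k + 1), PowerSeries.coeff i (aeval (PowerSeries.exp ℂ) q) •
        expWeight ((k : ℤ) - i) := by
  simp only [coeff_aeval_exp, Finset.sum_smul]
  rw [Finset.sum_comm]
  refine Finset.sum_congr rfl fun a _ => ?_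
  simp only [mul_smul, ← Finset.smul_sum]
  congr 1
  have h1 : expWeight (k : ℤ) = C (1 / (k.factorial : ℂ)) * X ^ k := by simp [expWeight]
  rw [h1, taylor_mul, taylor_C, taylor_X_pow, add_comm X, add_pow, Finset.mul_sum]
  refine Finset.sum_congr rfl fun i hi => ?_
  have hik : i ≤ k := Nat.lt_succ_iff.1 (Finset.mem_range.1 hi)
  have h2 : expWeight ((k : ℤ) - i) = C (1 / ((k - i).factorial : ℂ)) * X ^ (k - i) := by
    rw [expWeight, if_pos (by omega), show ((k : ℤ) - i).toNat = k - i by omega]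
  have h3 : (1 / (k.factorial : ℂ)) * (k.choose i : ℂ) =
      1 / (i.factorial : ℂ) * (1 / ((k - i).factorial : ℂ)) := by
    rw [Nat.cast_choose ℂ hik]
    have := k.factorial_ne_zero
    field_simp
  rw [h2, smul_eq_C_mul, div_eq_mul_one_div ((a : ℂ) ^ i), C_mul, C_pow, ← C_eq_natCast]
  calc _ = C ((1 / (k.factorial : ℂ)) * (k.choose i : ℂ)) * C (a : ℂ) ^ i * X ^ (k - i) := by
        rw [C_mul]; ring
    _ = _ := by rw [h3, C_mul]; ring

/-- The substitution `x₁ = x₂ e^z` turns `q(x₁/x₂)` into `q(e^z)`. -/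
theorem substExp_polShift (q : ℂ[X]) {S : ℤ × ℤ → W} (hS : IsLaurent S) (k j : ℤ) :
    substExp (polShift q (1, -1) S) (k, j) =
      powerMul (aeval (PowerSeries.exp ℂ) q) (fun k => substExp S (k, j)) k := by
  have h0 : ∀ k < (0 : ℤ), substExp S (k, j) = 0 := fun k hk => by
    simp [substExp, not_le.2 hk]
  have h1 := weightedDiag_polShift (0 : ℤ) 1 q (expWeight k) hS.mem_fibreFinite
  have h2 : AddMonoidHom.inr ℤ ℤ 0 + (1 : ℤ) • ((1, -1) : ℤ × ℤ) = (1, -1) := by simp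
  rw [h2] at h1
  rcases lt_or_ge k 0 with hk | hk
  · rw [powerMul_eq_zero _ h0 _ hk]
    simp [substExp, not_le.2 hk]
  obtain ⟨k, rfl⟩ := Int.eq_ofNat_of_zero_le hk
  have hs : ∀ (a : ℕ) (f : ℤ → W), (shift (0 : ℤ) ^ a) f = f := fun a f => by
    ext e; simp [shift_pow_apply]
  rw [powerMul_eq_sum _ h0 _ (k + 1) (by push_cast; omega), substExp_eq_weightedDiag, h1]
  have h3 := congrArg (weightedDiagLinear hS.mem_fibreFinite) (sum_taylor_expWeight q k)
  simp only [map_sum, map_smul] at h3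
  have h4 := congrFun h3 j
  simp only [Finset.sum_apply, Pi.smul_apply] at h4
  simp only [Finset.sum_apply, Pi.smul_apply, hs, Int.cast_one, mul_one, substExp_eq_weightedDiag]
  exact h4

end Act

/-! ### Associativity, solved for the coefficients, and covariance -/

section Module

universe u v

variable {V : Type u} [AddCommGroup V] [Module ℂ V] {A : WeakQVA V}
  {W : Type v} [AddCommGroup W] [Module ℂ W]

theorem exists_coeff_eq_zero_of_lt {W : Type*} [Zero W] (f : HahnSeries ℤ W) :
    ∃ N : ℤ, ∀ n < N, f.coeff n = 0 := by
  rcases eq_or_ne f 0 with rfl | h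
  · exact ⟨0, fun _ _ => rfl⟩
  · exact ⟨f.order, fun n hn => HahnSeries.coeff_eq_zero_of_lt_order hn⟩

namespace PhiQuasiModule

theorem coeff_trunc (M : PhiQuasiModule A W) (u v : V) :
    ∃ N : ℤ, ∀ n < N, ∀ w j, (M.YW ((A.Y u v).coeff n) w).coeff j = 0 := by
  obtain ⟨N, hN⟩ := exists_coeff_eq_zero_of_lt (A.Y u v)
  exact ⟨N, fun n hn w j => by simp [hN n hn]⟩

theorem exists_assoc (M : PhiQuasiModule A W) (u v : V) : ∃ p : ℂ[X], p ≠ 0 ∧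
    (∀ w, IsLaurent (polShift p (1, -1) (fieldMul (M.YW u) (M.YW v) w))) ∧
    ∀ w j, powerMul (aeval (PowerSeries.exp ℂ) p)
        (fun k => (M.YW ((A.Y u v).coeff k) w).coeff j) =
      fun k => substExp (polShift p (1, -1) (fieldMul (M.YW u) (M.YW v) w)) (k, j) := by
  obtain ⟨p, hp, hc, ha⟩ := M.assoc u v
  refine ⟨p, hp, fun w => (by simpa only [mulSeries_polyRatio] using hc w), fun w j => ?_⟩
  ext k
  have := congrFun (ha w) (k, j)
  rwa [mulSeries_polyExp, mulSeries_polyRatio] at this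

/-- The coefficients of `Y_W(uₙ v, x)` are weighted antidiagonal sums of the coefficients of
`p(x₁/x) Y_W(u, x₁) Y_W(v, x)`, for a suitable polynomial `p` and a polynomial weight. -/
theorem exists_coeff_eq_finsum (M : PhiQuasiModule A W) (u v : V) (n : ℤ) : ∃ p c : ℂ[X],
    (∀ w, IsLaurent (polShift p (1, -1) (fieldMul (M.YW u) (M.YW v) w))) ∧
    ∀ w j, (M.YW ((A.Y u v).coeff n) w).coeff j =
      ∑ᶠ m : ℤ, c.eval (m : ℂ) •
        polShift p (1, -1) (fieldMul (M.YW u) (M.YW v) w) (m, j - m) := by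
  obtain ⟨p, hp, hc, ha⟩ := M.exists_assoc u v
  obtain ⟨N, hN⟩ := M.coeff_trunc u v
  obtain ⟨c, h⟩ := exists_weight_of_powerMul (W := W) _ (aeval_exp_ne_zero hp) N n
  refine ⟨p, c, hc, fun w j => ?_⟩
  rw [← weightedDiag_antidiagonal]
  refine h (fun k => (M.YW ((A.Y u v).coeff k) w).coeff j)
    (LinearMap.proj j ∘ₗ weightedDiagLinear (hc w).mem_fibreFinite) (fun k hk => hN k hk w j)
    (fun k => ?_)
  rw [ha]
  exact substExp_eq_weightedDiag _ _ _

theorem coeff_scale (c : ℂˣ) (a : FieldOn W) (w : W) (n : ℤ) :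
    (a.scale c w).coeff n = ((c ^ n : ℂˣ) : ℂ) • (a w).coeff n := rfl

theorem fieldMul_scale (c : ℂˣ) (a b : FieldOn W) (w : W) (e : ℤ × ℤ) :
    fieldMul (a.scale c) (b.scale c) w e = ((c ^ (e.1 + e.2) : ℂˣ) : ℂ) • fieldMul a b w e := by
  simp only [fieldMul, coeff_scale, map_smul, HahnSeries.coeff_smul, smul_smul, zpow_add,
    Units.val_mul, mul_comm]

theorem polShift_fieldMul_scale (c : ℂˣ) (p : ℂ[X]) (a b : FieldOn W) (w : W) (e : ℤ × ℤ) :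
    polShift p (1, -1) (fieldMul (a.scale c) (b.scale c) w) e =
      ((c ^ (e.1 + e.2) : ℂˣ) : ℂ) • polShift p (1, -1) (fieldMul a b w) e := by
  simp only [polShift_apply, fieldMul_scale, Finset.smul_sum]
  refine Finset.sum_congr rfl fun k _ => ?_
  have h : (e - k • ((1, -1) : ℤ × ℤ)).1 + (e - k • ((1, -1) : ℤ × ℤ)).2 = e.1 + e.2 := by
    simp
  rw [smul_comm, h]

theorem substExp_smul_homogeneous (c : ℂˣ) {S S' : ℤ × ℤ → W}
    (h : ∀ e, S' e = ((c ^ (e.1 + e.2) : ℂˣ) : ℂ) • S e) (k j : ℤ) :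
    substExp S' (k, j) = ((c ^ j : ℂˣ) : ℂ) • substExp S (k, j) := by
  unfold substExp
  split_ifs
  · rw [smul_finsum]
    refine finsum_congr fun m => ?_
    rw [h, smul_comm]
    simp
  · simp

/-- The relation `Y_W(u', x) = Y_W(u, cx)` passes from `u` and `v` to the coefficients of
`Y(u, z)v`. Associativity for `(u, v)` and for `(u', v')` comes with different polynomials `p` and
`p'`, so the comparison takes place after multiplication by `p(e^z) p'(e^z)`. -/
theorem YW_scale_coeff (M : PhiQuasiModule A W) (c : ℂˣ) {u v u' v' : V}
    (hu : M.YW u' = (M.YW u).scale c) (hv : M.YW v' = (M.YW v).scale c) (n : ℤ) :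
    M.YW ((A.Y u' v').coeff n) = (M.YW ((A.Y u v).coeff n)).scale c := by
  obtain ⟨p, hp, hpL, ha⟩ := M.exists_assoc u v
  obtain ⟨p', hp', hpL', ha'⟩ := M.exists_assoc u' v'
  obtain ⟨N, hN⟩ := M.coeff_trunc u v
  obtain ⟨N', hN'⟩ := M.coeff_trunc u' v'
  ext w j
  set G : ℤ → W := fun k => (M.YW ((A.Y u v).coeff k) w).coeff j with hG
  set G' : ℤ → W := fun k => (M.YW ((A.Y u' v').coeff k) w).coeff j with hG'
  set r : ℂ := ((c ^ j : ℂˣ) : ℂ) with hr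
  have hlin : ∀ (H : PowerSeries ℂ) (F : ℤ → W), powerMul H (r • F) = r • powerMul H F := by
    intro H F
    ext k
    simp only [powerMul, Pi.smul_apply, smul_finsum]
    exact finsum_congr fun i => smul_comm _ _ _
  set P := aeval (PowerSeries.exp ℂ) p
  set P' := aeval (PowerSeries.exp ℂ) p'
  have h1 : powerMul P (powerMul P' G') = powerMul P (powerMul P' (r • G)) := by
    rw [powerMul_comm P P' (N := N) (G := r • G) (fun k hk => by simp [hG, hN k hk]), hlin, hlin,
      ha w j, ha' w j]
    ext k
    rw [← substExp_polShift _ (hpL' w), Pi.smul_apply, ← substExp_polShift _ (hpL w),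
      polShift_comm p p']
    refine substExp_smul_homogeneous c (fun e => ?_) k j
    rw [← polShift_mul, ← polShift_mul, hu, hv, polShift_fieldMul_scale]
  have hsub : ∀ (H : PowerSeries ℂ) (F F' : ℤ → W) (L : ℤ), (∀ k < L, F k = 0) →
      (∀ k < L, F' k = 0) → powerMul H (F - F') = powerMul H F - powerMul H F' := by
    intro H F F' L hF hF'
    ext k
    have hL : k - L < ((k - L).toNat + 1 : ℕ) := by omega
    rw [Pi.sub_apply, powerMul_eq_sum H hF k _ hL, powerMul_eq_sum H hF' k _ hL,
      powerMul_eq_sum H (N := L) (fun k hk => by simp [hF k hk, hF' k hk]) k _ hL,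
      ← Finset.sum_sub_distrib]
    simp [smul_sub]
  have t1 : ∀ k < min N N', G' k = 0 := fun k hk => hN' k (by omega) w j
  have t2 : ∀ k < min N N', (r • G) k = 0 := fun k hk => by simp [hG, hN k (by omega)]
  have h2 : G' - r • G = 0 := by
    have t3 : ∀ k < min N N', (G' - r • G) k = 0 := fun k hk => by
      rw [Pi.sub_apply, t1 k hk, t2 k hk, sub_zero]
    refine eq_zero_of_powerMul_eq_zero (aeval_exp_ne_zero hp') t3
      (eq_zero_of_powerMul_eq_zero (aeval_exp_ne_zero hp) (powerMul_eq_zero _ t3) ?_)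
    rw [hsub _ _ _ _ t1 t2, hsub _ _ _ _ (powerMul_eq_zero _ t1) (powerMul_eq_zero _ t2), h1,
      sub_self]
  exact sub_eq_zero.1 (congrFun h2 n)

end PhiQuasiModule

theorem WeakQVA.IsGenerating.eq_top {U : Set V} (hU : A.IsGenerating U) (N : Submodule ℂ V)
    (hvac : A.vac ∈ N) (hmode : ∀ u ∈ U, ∀ v ∈ N, ∀ n, (A.Y u v).coeff n ∈ N) : N = ⊤ := by
  rw [eq_top_iff, ← hU, Submodule.span_le]
  rintro w ⟨l, hl, rfl⟩
  induction l with
  | nil => exact hvac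
  | cons q l ih =>
    exact hmode _ (hl q (by simp)) _ (ih fun q hq => hl q (by simp [hq])) _

theorem PhiQuasiModule.YW_apply_eq_scale (M : PhiQuasiModule A W) {G : Type*} [Group G]
    (ρ : G →* A.Aut) (χ : G →* ℂˣ) {U : Set V} (hU : A.IsGenerating U)
    (hcov : ∀ u ∈ U, ∀ g : G, M.YW ((ρ g : V ≃ₗ[ℂ] V) u) = (M.YW u).scale (χ g))
    (g : G) (v : V) : M.YW ((ρ g : V ≃ₗ[ℂ] V) v) = (M.YW v).scale (χ g) := by
  let N : Submodule ℂ V :=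
    { carrier := {v | M.YW ((ρ g : V ≃ₗ[ℂ] V) v) = (M.YW v).scale (χ g)}
      zero_mem' := by simp [FieldOn.scale]
      add_mem' := fun {a b} ha hb => by
        change M.YW ((ρ g : V ≃ₗ[ℂ] V) (a + b)) = _
        rw [map_add, map_add, ha, hb, map_add]
        exact (LinearMap.comp_add _ _ _).symm
      smul_mem' := fun r a ha => by
        change M.YW ((ρ g : V ≃ₗ[ℂ] V) (r • a)) = _
        rw [map_smul, map_smul, ha, map_smul]
        exact (LinearMap.comp_smul _ _ _).symm }
  have hN : N = ⊤ := by
    refine hU.eq_top N ?_ ?_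
    · change M.YW ((ρ g : V ≃ₗ[ℂ] V) A.vac) = (M.YW A.vac).scale (χ g)
      rw [(ρ g).2.1]
      ext w n
      rw [PhiQuasiModule.coeff_scale, M.vac_act]
      by_cases h : n = 0
      · simp [h]
      · simp [HahnSeries.coeff_single_of_ne h]
    · intro u hu v hv n
      change M.YW ((ρ g : V ≃ₗ[ℂ] V) ((A.Y u v).coeff n)) = _
      rw [(ρ g).2.2]
      exact M.YW_scale_coeff _ (hcov u hu g) hv n
  have : v ∈ N := hN ▸ Submodule.mem_top
  exact this

end Module

/-! ### Polynomials with zeros in a subgroup -/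

section Zeros

variable {Γ : Subgroup ℂˣ}

theorem ZerosIn.one : ZerosIn Γ 1 := ⟨one_ne_zero, fun t ht => by simp [IsRoot] at ht⟩

theorem ZerosIn.mul {p q : ℂ[X]} (hp : ZerosIn Γ p) (hq : ZerosIn Γ q) : ZerosIn Γ (p * q) :=
  ⟨mul_ne_zero hp.1 hq.1, fun t ht => (root_mul.1 ht).elim (hp.2 t) (hq.2 t)⟩

theorem ZerosIn.pow {p : ℂ[X]} (hp : ZerosIn Γ p) (n : ℕ) : ZerosIn Γ (p ^ n) := by
  induction n with
  | zero => simpa using ZerosIn.one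
  | succ n ih => exact pow_succ p n ▸ ih.mul hp

theorem ZerosIn.prod {ι : Type*} (s : Finset ι) {p : ι → ℂ[X]} (hp : ∀ i, ZerosIn Γ (p i)) :
    ZerosIn Γ (∏ i ∈ s, p i) :=
  Finset.prod_induction _ _ (fun _ _ => ZerosIn.mul) ZerosIn.one fun i _ => hp i

theorem ZerosIn.coeff_zero_ne_zero {p : ℂ[X]} (hp : ZerosIn Γ p) : p.coeff 0 ≠ 0 := by
  intro h
  obtain ⟨c, _, hc⟩ := hp.2 0 (by rwa [IsRoot, ← coeff_zero_eq_eval_zero])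
  exact c.ne_zero hc

end Zeros

/-! ### Moving a local field to the right -/

section Locality

variable {W : Type*} [AddCommGroup W] [Module ℂ W] {K : Type*} [AddCommGroup K]

theorem polShift_mem_bddBelow_of_dvd {Γ : Type*} [AddCommGroup Γ] {π : Γ →+ ℤ} {p q : ℂ[X]}
    (h : p ∣ q) {γ : Γ} {f : Γ → W} (hf : polShift p γ f ∈ bddBelow π) :
    polShift q γ f ∈ bddBelow π := by
  obtain ⟨r, rfl⟩ := h
  rw [mul_comm, polShift_mul]
  exact polShift_mem_bddBelow _ _ _ hf

theorem polShift_polShift_mem_bddBelow_of_dvd {Γ : Type*} [AddCommGroup Γ] {π : Γ →+ ℤ}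
    {p q : ℂ[X]} (h : p ∣ q) {γ γ' : Γ} {f : Γ → W}
    (hf : polShift p γ (polShift p γ' f) ∈ bddBelow π) :
    polShift q γ (polShift q γ' f) ∈ bddBelow π := by
  refine polShift_mem_bddBelow_of_dvd h ?_
  rw [polShift_comm] at hf ⊢
  exact polShift_mem_bddBelow_of_dvd h hf

/-- The product `F(x, y) b(y) g(x)`, where `g` may involve further variables with exponents in
`K`; exponents of `(x, y)` and those in `K`. -/
noncomputable def applyConv (F : ℤ × ℤ → ℂ) (b : FieldOn W) (g : ℤ × K → W) : ℤ × ℤ × K → W :=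
  fun e => ∑ᶠ d : ℤ × ℤ, F d • (b (g (e.1 - d.1, e.2.2))).coeff (e.2.1 - d.2)

theorem iotaRatio_fst (f : RatFunc ℂ) : ∃ N : ℤ, ∀ e, e.1 < N → iotaRatio f e = 0 := by
  obtain ⟨N, hN⟩ := exists_coeff_eq_zero_of_lt (ratEval f (innerVar / outerVar))
  exact ⟨N, fun e he => by simp [iotaRatio, iterCoeff, hN _ he]⟩

theorem iotaRatio_snd (f : RatFunc ℂ) (m : ℤ) : ∃ N : ℤ, ∀ n < N, iotaRatio f (m, n) = 0 :=
  exists_coeff_eq_zero_of_lt ((ratEval f (innerVar / outerVar)).coeff m)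

theorem finite_support_applyConv (f : RatFunc ℂ) (b : FieldOn W) {g : ℤ × K → W}
    (hg : g ∈ bddBelowOnFibres W (AddMonoidHom.fst ℤ K) (AddMonoidHom.snd ℤ K))
    (e : ℤ × ℤ × K) : (Function.support fun d : ℤ × ℤ =>
      iotaRatio f d • (b (g (e.1 - d.1, e.2.2))).coeff (e.2.1 - d.2)).Finite := by
  obtain ⟨N, hN⟩ := iotaRatio_fst f
  choose M hM using iotaRatio_snd f
  obtain ⟨L, hL⟩ := hg e.2.2
  choose R hR using fun d : ℤ => exists_coeff_eq_zero_of_lt (b (g (e.1 - d, e.2.2)))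
  refine ((Set.finite_Icc N (e.1 - L)).biUnion fun d _ =>
    (Set.finite_Icc (M d) (e.2.1 - R d)).image fun d' => (d, d')).subset ?_
  rintro ⟨d, d'⟩ hd
  simp only [Set.mem_iUnion, Set.mem_image]
  refine ⟨d, ⟨?_, ?_⟩, d', ⟨?_, ?_⟩, rfl⟩ <;> by_contra h <;> refine hd ?_ <;> simp only
  · rw [hN _ (not_le.1 h), zero_smul]
  · rw [hL (e.1 - d, e.2.2) rfl (by simp at h ⊢; omega), map_zero, HahnSeries.coeff_zero,
      smul_zero]
  · rw [hM _ _ (not_le.1 h), zero_smul]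
  · rw [hR _ _ (by omega), smul_zero]

theorem applyConv_polShift (f : RatFunc ℂ) (b : FieldOn W) {g : ℤ × K → W}
    (hg : g ∈ bddBelowOnFibres W (AddMonoidHom.fst ℤ K) (AddMonoidHom.snd ℤ K))
    (p : ℂ[X]) (i : ℤ) (κ : K) :
    applyConv (iotaRatio f) b (polShift p (i, κ) g) =
      polShift p (i, 0, κ) (applyConv (iotaRatio f) b g) := by
  ext e
  have h : ∀ (k : ℕ) (d : ℤ × ℤ), iotaRatio f d •
      (b (g ((e.1 - d.1, e.2.2) - k • (i, κ)))).coeff (e.2.1 - d.2) =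
      iotaRatio f d • (b (g ((e - k • (i, (0 : ℤ), κ)).1 - d.1, (e - k • (i, (0 : ℤ), κ)).2.2))).coeff
        ((e - k • (i, (0 : ℤ), κ)).2.1 - d.2) := by
    intro k d
    have h1 : (e.1 - d.1, e.2.2) - k • (i, κ) =
        ((e - k • (i, (0 : ℤ), κ)).1 - d.1, (e - k • (i, (0 : ℤ), κ)).2.2) := by
      ext
      · simp only [Prod.fst_sub, Prod.smul_fst]
        abel
      · simp
    rw [h1]
    simp
  rw [polShift_apply]
  simp only [applyConv, polShift_apply, map_sum, map_smul, HahnSeries.coeff_sum,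
    HahnSeries.coeff_smul, Finset.smul_sum]
  rw [finsum_sum_comm]
  · refine Finset.sum_congr rfl fun k _ => ?_
    rw [smul_finsum]
    refine finsum_congr fun d => ?_
    rw [smul_comm, h]
  · intro k _
    refine (finite_support_applyConv f b hg (e - k • (i, (0 : ℤ), κ))).subset fun d hd h0 => hd ?_
    simp only at h0 ⊢
    rw [smul_comm, h, h0, smul_zero]

theorem applyConv_mem_bddBelow (f : RatFunc ℂ) (b : FieldOn W) {g : ℤ × K → W}
    (hg : g ∈ bddBelow (AddMonoidHom.fst ℤ K)) :
    applyConv (iotaRatio f) b g ∈ bddBelow (AddMonoidHom.fst ℤ (ℤ × K)) := by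
  obtain ⟨N, hN⟩ := iotaRatio_fst f
  obtain ⟨M, hM⟩ := hg
  refine ⟨N + M, fun e he => ?_⟩
  refine (finsum_congr fun d => ?_).trans finsum_zero
  by_cases hd : d.1 < N
  · rw [hN d hd, zero_smul]
  · rw [hM (e.1 - d.1, e.2.2) (by simp at he ⊢; omega), map_zero, HahnSeries.coeff_zero, smul_zero]

/-- If all fields `a'` of a finite family in `S` make `a'(x) ω` bounded below in `x`, after
multiplication by `q(x^(1,κ)) q(x^(1,κ'))`, then the same holds for `a(x) b(y) ω` after
multiplication by a further `p(x/y)`. The variables of `ω` have exponents in `K`. -/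
theorem IsQuasiTrigLocal.exists_mem_bddBelow {Γ : Subgroup ℂˣ} {S : Set (FieldOn W)}
    (hS : IsQuasiTrigLocal Γ S) {a b : FieldOn W} (ha : a ∈ S) (hb : b ∈ S) :
    ∃ (r : ℕ) (a' : Fin r → FieldOn W) (p : ℂ[X]), (∀ i, a' i ∈ S) ∧ ZerosIn Γ p ∧
      ∀ (ω : K → W) (q : ℂ[X]) (κ κ' : K),
        (∀ i, polShift q (1, κ) (polShift q (1, κ') fun e : ℤ × K => (a' i (ω e.2)).coeff e.1) ∈
          bddBelow (AddMonoidHom.fst ℤ K)) →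
        polShift p (1, -1, 0) (polShift q (1, 0, κ) (polShift q (1, 0, κ')
          fun e : ℤ × ℤ × K => (a ((b (ω e.2.2)).coeff e.2.1)).coeff e.1)) ∈
          bddBelow (AddMonoidHom.fst ℤ (ℤ × K)) := by
  obtain ⟨r, a', b', f, p, ha', -, hp, h⟩ := hS a ha b hb
  refine ⟨r, a', p, ha', hp, fun ω q κ κ' hq => ?_⟩
  have hω : ∀ i, (fun e : ℤ × K => (a' i (ω e.2)).coeff e.1) ∈
      bddBelowOnFibres W (AddMonoidHom.fst ℤ K) (AddMonoidHom.snd ℤ K) := by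
    intro i k
    obtain ⟨N, hN⟩ := exists_coeff_eq_zero_of_lt (a' i (ω k))
    refine ⟨N, ?_⟩
    rintro ⟨m, _⟩ rfl hm
    exact hN _ hm
  have hsh : ∀ (k : ℕ) (e : ℤ × ℤ × K), e - k • ((1, -1, 0) : ℤ × ℤ × K) =
      (((e.1, e.2.1) - k • ((1, -1) : ℤ × ℤ)).1, ((e.1, e.2.1) - k • ((1, -1) : ℤ × ℤ)).2,
        e.2.2) := by
    intro k e
    ext <;> simp
  have key : polShift p (1, -1, 0)
      (fun e : ℤ × ℤ × K => (a ((b (ω e.2.2)).coeff e.2.1)).coeff e.1) =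
      polShift p (1, -1, 0) (∑ i, applyConv (iotaRatio (f i)) (b' i)
        fun e : ℤ × K => (a' i (ω e.2)).coeff e.1) := by
    ext e
    have h1 := congrFun (h (ω e.2.2)) (e.1, e.2.1)
    rw [mulSeries_polyRatio, mulSeries_polyRatio, polShift_apply, polShift_apply] at h1
    rw [polShift_apply, polShift_apply]
    simp only [hsh]
    refine h1.trans (Finset.sum_congr rfl fun k _ => ?_)
    simp only [Finset.sum_apply]
    rfl
  rw [polShift_comm q q, polShift_comm p q, polShift_comm p q, key, ← polShift_comm p q,
    ← polShift_comm p q, polShift_comm q q]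
  refine polShift_mem_bddBelow _ _ _ ?_
  simp only [map_sum]
  refine Submodule.sum_mem _ fun i _ => ?_
  rw [← applyConv_polShift _ _ (hω i),
    ← applyConv_polShift _ _ (polShift_mem_bddBelowOnFibres _ _ _ _ (hω i))]
  exact applyConv_mem_bddBelow _ _ (hq i)

end Locality

/-! ### Products of two and of three fields -/

section Products

universe u v

variable {W : Type v} [AddCommGroup W] [Module ℂ W] {J : Type*}

/-- For a family `ξ` of series in `z`, there is one polynomial `p` with zeros in `Γ` such that
`p(x/z) a(x) ξₜ(z)` is bounded below in `x` for all `t`. -/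
def IsPairBdd (Γ : Subgroup ℂˣ) (ξ : J → ℤ → W) (a : FieldOn W) : Prop :=
  ∃ p : ℂ[X], ZerosIn Γ p ∧ ∀ t,
    polShift p (1, -1) (fun e : ℤ × ℤ => (a (ξ t e.2)).coeff e.1) ∈
      bddBelow (AddMonoidHom.fst ℤ ℤ)

/-- `a(x) b(y) ξ(z)`; exponents of `(x, y, z)`. -/
def tripleSeries (a b : FieldOn W) (ξ : ℤ → W) : ℤ × ℤ × ℤ → W :=
  fun e => (a ((b (ξ e.2.2)).coeff e.2.1)).coeff e.1

/-- For a family `ξ` of series in `z`, there is one polynomial `p` with zeros in `Γ` such that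
`p(x/y) p(x/z) a(x) b(y) ξₜ(z)` is bounded below in `x` for all `t`. -/
def IsTripleBdd (Γ : Subgroup ℂˣ) (ξ : J → ℤ → W) (a b : FieldOn W) : Prop :=
  ∃ p : ℂ[X], ZerosIn Γ p ∧ ∀ t,
    polShift p (1, -1, 0) (polShift p (1, 0, -1) (tripleSeries a b (ξ t))) ∈
      bddBelow (AddMonoidHom.fst ℤ (ℤ × ℤ))

variable {Γ : Subgroup ℂˣ} {ξ : J → ℤ → W}

theorem isPairBdd_single (a : FieldOn W) : IsPairBdd Γ (fun w : W => Pi.single (0 : ℤ) w) a := by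
  refine ⟨1, ZerosIn.one, fun w => ?_⟩
  rw [polShift_one]
  obtain ⟨N, hN⟩ := exists_coeff_eq_zero_of_lt (a w)
  refine ⟨N, fun e he => ?_⟩
  rcases eq_or_ne e.2 0 with h | h
  · simp only [h, Pi.single_eq_same]
    exact hN _ he
  · simp [Pi.single_eq_of_ne h]

theorem IsPairBdd.add {a b : FieldOn W} (ha : IsPairBdd Γ ξ a) (hb : IsPairBdd Γ ξ b) :
    IsPairBdd Γ ξ (a + b) := by
  obtain ⟨p, hp, hpa⟩ := ha
  obtain ⟨q, hq, hqb⟩ := hb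
  refine ⟨p * q, hp.mul hq, fun t => ?_⟩
  have := (bddBelow _).add_mem (polShift_mem_bddBelow_of_dvd (dvd_mul_right p q) (hpa t))
    (polShift_mem_bddBelow_of_dvd (dvd_mul_left q p) (hqb t))
  rwa [← map_add] at this

theorem IsPairBdd.smul (c : ℂ) {a : FieldOn W} (ha : IsPairBdd Γ ξ a) :
    IsPairBdd Γ ξ (c • a) := by
  obtain ⟨p, hp, hpa⟩ := ha
  refine ⟨p, hp, fun t => ?_⟩
  have := (bddBelow _).smul_mem c (hpa t)
  rwa [← map_smul] at this

theorem isPairBdd_zero : IsPairBdd Γ ξ 0 :=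
  ⟨1, ZerosIn.one, fun t => by rw [polShift_one]; exact ⟨0, fun _ _ => rfl⟩⟩

theorem IsTripleBdd.add {a b b' : FieldOn W} (hb : IsTripleBdd Γ ξ a b)
    (hb' : IsTripleBdd Γ ξ a b') : IsTripleBdd Γ ξ a (b + b') := by
  obtain ⟨p, hp, hpa⟩ := hb
  obtain ⟨q, hq, hqb⟩ := hb'
  refine ⟨p * q, hp.mul hq, fun t => ?_⟩
  have := (bddBelow _).add_mem (polShift_polShift_mem_bddBelow_of_dvd (dvd_mul_right p q) (hpa t))
    (polShift_polShift_mem_bddBelow_of_dvd (dvd_mul_left q p) (hqb t))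
  rw [← map_add, ← map_add] at this
  convert this using 3
  ext e
  simp [tripleSeries]

theorem IsTripleBdd.smul (c : ℂ) {a b : FieldOn W} (hb : IsTripleBdd Γ ξ a b) :
    IsTripleBdd Γ ξ a (c • b) := by
  obtain ⟨p, hp, hpa⟩ := hb
  refine ⟨p, hp, fun t => ?_⟩
  have := (bddBelow _).smul_mem c (hpa t)
  rw [← map_smul, ← map_smul] at this
  convert this using 3
  ext e
  simp [tripleSeries]

theorem isTripleBdd_zero {a : FieldOn W} : IsTripleBdd Γ ξ a 0 :=
  ⟨1, ZerosIn.one, fun t => by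
    rw [polShift_one, polShift_one]; exact ⟨0, fun _ _ => by simp [tripleSeries]⟩⟩

theorem IsPairBdd.isTripleBdd_one {a b : FieldOn W} (hb : ∀ w, b w = HahnSeries.single 0 w)
    (h : IsPairBdd Γ ξ a) : IsTripleBdd Γ ξ a b := by
  obtain ⟨p, hp, hpa⟩ := h
  refine ⟨p, hp, fun t => polShift_mem_bddBelow _ _ _ ?_⟩
  let Φ : (ℤ × ℤ → W) →ₗ[ℂ] (ℤ × ℤ × ℤ → W) :=
    { toFun := fun g e => if e.2.1 = 0 then g (e.1, e.2.2) else 0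
      map_add' := fun f g => by ext e; by_cases h : e.2.1 = 0 <;> simp [h]
      map_smul' := fun c f => by ext e; by_cases h : e.2.1 = 0 <;> simp [h] }
  have h1 : tripleSeries a b (ξ t) = Φ fun e : ℤ × ℤ => (a (ξ t e.2)).coeff e.1 := by
    ext e
    simp only [tripleSeries, hb, Φ, LinearMap.coe_mk, AddHom.coe_mk]
    split_ifs with h
    · simp [h]
    · simp [HahnSeries.coeff_single_of_ne h]
  rw [h1, ← map_polShift Φ (γ := (1, -1)) (γ' := (1, 0, -1))
    (fun f => by ext e; simp [Φ, shift_apply])]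
  obtain ⟨N, hN⟩ := hpa t
  refine ⟨N, fun e he => ?_⟩
  simp only [Φ, LinearMap.coe_mk, AddHom.coe_mk]
  rw [hN _ he, ite_self]

/-- For constant series `ξ`, the factor `p(x/z)` only contributes its nonzero constant term to the
coefficient of `z⁰`. -/
theorem IsTripleBdd.isPairBdd {a b : FieldOn W}
    (h : IsTripleBdd Γ (fun w : W => Pi.single (0 : ℤ) w) a b) :
    IsPairBdd Γ (fun w n => (b w).coeff n) a := by
  obtain ⟨p, hp, hpa⟩ := h
  refine ⟨p, hp, fun w => ?_⟩
  obtain ⟨N, hN⟩ := hpa w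
  refine ⟨N, fun e he => ?_⟩
  have h1 := hN (e.1, e.2, 0) he
  rw [polShift_comm, polShift_apply, Finset.sum_eq_single 0] at h1
  · have h2 := (smul_eq_zero.1 h1).resolve_left hp.coeff_zero_ne_zero
    rw [polShift_apply] at h2 ⊢
    rw [← h2]
    refine Finset.sum_congr rfl fun k _ => ?_
    simp [tripleSeries]
  · intro k _ hk
    rw [polShift_apply]
    simp [tripleSeries, hk]
  · simp

namespace PhiQuasiModule

variable {V : Type u} [AddCommGroup V] [Module ℂ V] {A : WeakQVA V}

/-- The induction step in the middle factor: `y` is merged into `z` in `a(x) Y_W(u',y) Y_W(v,z) ξ`.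
A fourth variable carries `ξ`. -/
theorem isTripleBdd_coeff (M : PhiQuasiModule A W) {U : Set V}
    (hloc : IsQuasiTrigLocal Γ {a | ∃ u ∈ U, M.YW u = a}) {v : V}
    (hv : ∀ u ∈ U, IsTripleBdd Γ ξ (M.YW u) (M.YW v)) {u u' : V} (hu : u ∈ U) (hu' : u' ∈ U)
    (n : ℤ) : IsTripleBdd Γ ξ (M.YW u) (M.YW ((A.Y u' v).coeff n)) := by
  obtain ⟨r, a', p, ha', hp, hmove⟩ :=
    hloc.exists_mem_bddBelow (K := ℤ × ℤ) ⟨u, hu, rfl⟩ ⟨u', hu', rfl⟩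
  have hq : ∀ i, IsTripleBdd Γ ξ (a' i) (M.YW v) := fun i => by
    obtain ⟨u₁, hu₁, h⟩ := ha' i
    exact h ▸ hv u₁ hu₁
  choose q hq0 hq using hq
  obtain ⟨h, c, hL, hc⟩ := M.exists_coeff_eq_finsum u' v n
  set Q := ∏ i, q i with hQ
  refine ⟨Q * p ^ (c.natDegree + 1), (ZerosIn.prod _ hq0).mul (hp.pow _), fun t => ?_⟩
  set E : ℤ × ℤ × ℤ × ℤ → W := fun e =>
    (M.YW u ((M.YW u' ((M.YW v (ξ t e.2.2.2)).coeff e.2.2.1)).coeff e.2.1)).coeff e.1 with hE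
  -- moving `Y_W(u, x)` past `Y_W(u', y)` bounds the exponents of `x`
  have hEb : polShift p (1, -1, 0, 0) (polShift Q (1, 0, -1, 0) (polShift Q (1, 0, 0, -1) E)) ∈
      bddBelow (AddMonoidHom.fst ℤ (ℤ × ℤ × ℤ)) :=
    hmove (fun e => (M.YW v (ξ t e.2)).coeff e.1) Q (-1, 0) (0, -1) fun i =>
      polShift_polShift_mem_bddBelow_of_dvd (Finset.dvd_prod_of_mem _ (Finset.mem_univ i)) (hq i t)
  set E' := polShift h (0, 1, -1, 0) E with hE'
  have hE'_apply : ∀ i m j l, E' (i, m, j, l) =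
      (M.YW u (polShift h (1, -1) (fieldMul (M.YW u') (M.YW v) (ξ t l)) (m, j))).coeff i := by
    intro i m j l
    simp [hE', hE, polShift_apply, fieldMul, HahnSeries.coeff_sum]
  let σ : ℤ × ℤ × ℤ →+ ℤ × ℤ × ℤ × ℤ :=
    (AddMonoidHom.id ℤ).prodMap (AddMonoidHom.inr ℤ (ℤ × ℤ))
  let δ : ℤ × ℤ × ℤ × ℤ := (0, 1, -1, 0)
  have hσ : ∀ (k : ℤ × ℤ × ℤ) (m : ℤ), σ k + m • δ = (k.1, m, k.2.1 - m, k.2.2) := by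
    intro k m
    ext <;> simp [σ, δ, sub_eq_add_neg]
  have hfib : E' ∈ fibreFinite W σ δ := by
    intro k
    refine ((hL (ξ t k.2.2)).finite_antidiagonal k.2.1).subset fun m hm h0 => hm ?_
    simp only at h0 ⊢
    rw [hσ, hE'_apply, h0, map_zero, HahnSeries.coeff_zero]
  have hdiag : weightedDiag σ δ c E' = tripleSeries (M.YW u) (M.YW ((A.Y u' v).coeff n)) (ξ t) := by
    ext k
    let L : W →ₗ[ℂ] W :=
      { toFun := fun w => (M.YW u w).coeff k.1
        map_add' := fun x y => by simp
        map_smul' := fun r x => by simp }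
    rw [tripleSeries, hc]
    change _ = L _
    have := (L.toAddMonoidHom).map_finsum (f := fun m : ℤ => c.eval (m : ℂ) •
      polShift h (1, -1) (fieldMul (M.YW u') (M.YW v) (ξ t k.2.2)) (m, k.2.1 - m))
      (((hL (ξ t k.2.2)).finite_antidiagonal k.2.1).subset
        (Function.support_smul_subset_right _ _))
    refine Eq.trans (finsum_congr fun m => ?_) this.symm
    rw [hσ, hE'_apply]
    exact (L.map_smul _ _).symm
  let B : Submodule ℂ (ℤ × ℤ × ℤ → W) := (bddBelow (AddMonoidHom.fst ℤ (ℤ × ℤ))).comap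
    (polShift Q (1, -1, 0) ∘ₗ polShift Q (1, 0, -1))
  have hB : ∀ f, f ∈ B ↔ polShift Q (1, -1, 0) (polShift Q (1, 0, -1) f) ∈
    bddBelow (AddMonoidHom.fst ℤ (ℤ × ℤ)) := fun f => Iff.rfl
  have hmain := polShift_pow_weightedDiag_mem (σ := σ) (δ := δ) B (1, -1, 0) (by
    intro f hf
    rw [hB, shift_eq_polShift_X, polShift_comm Q X, polShift_comm Q X]
    exact polShift_mem_bddBelow _ _ _ hf) (-1) p hfib (by
    intro c
    have s1 : σ (1, -1, 0) = (1, 0, -1, 0) := rfl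
    have s2 : σ (1, 0, -1) = (1, 0, 0, -1) := rfl
    have s3 : σ (1, -1, 0) + (-1 : ℤ) • δ = (1, -1, 0, 0) := rfl
    have hfib' := polShift_mem_fibreFinite (1, -1, 0) (-1) p hfib
    have hfib'' := polShift_mem_fibreFinite (1, 0, -1) 0 Q hfib'
    rw [zero_smul, add_zero] at hfib''
    rw [hB, ← weightedDiag_polShift_map _ _ _ hfib', ← weightedDiag_polShift_map _ _ _ hfib'',
      s3, s1, s2, hE',
      polShift_comm p h, polShift_comm Q h, polShift_comm Q h, polShift_comm Q p,
      polShift_comm Q p]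
    obtain ⟨N, hN⟩ := polShift_mem_bddBelow _ h (0, 1, -1, 0) hEb
    refine ⟨N, fun k hk => (finsum_congr fun m => ?_).trans finsum_zero⟩
    rw [hN _ (by rw [hσ]; exact hk), smul_zero]) c
  rw [hdiag, hB] at hmain
  rw [polShift_mul, polShift_mul, polShift_comm (p ^ _) Q (1, -1, 0) (1, 0, -1),
    polShift_comm (p ^ _) (p ^ _) (1, -1, 0) (1, 0, -1),
    polShift_comm Q (p ^ _) (1, 0, -1) (1, 0, -1), polShift_comm Q (p ^ _) (1, -1, 0) (1, 0, -1)]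
  exact polShift_mem_bddBelow _ _ _ hmain

theorem isTripleBdd (M : PhiQuasiModule A W) {U : Set V} (hU : A.IsGenerating U)
    (hloc : IsQuasiTrigLocal Γ {a | ∃ u ∈ U, M.YW u = a})
    (h : ∀ u ∈ U, IsPairBdd Γ ξ (M.YW u)) (v : V) :
    ∀ u ∈ U, IsTripleBdd Γ ξ (M.YW u) (M.YW v) := by
  let N : Submodule ℂ V :=
    { carrier := {v | ∀ u ∈ U, IsTripleBdd Γ ξ (M.YW u) (M.YW v)}
      zero_mem' := fun u _ => by rw [map_zero]; exact isTripleBdd_zero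
      add_mem' := fun hv hv' u hu => by rw [map_add]; exact (hv u hu).add (hv' u hu)
      smul_mem' := fun c v hv u hu => by rw [map_smul]; exact (hv u hu).smul c }
  have hN : N = ⊤ := hU.eq_top N
    (fun u hu => (h u hu).isTripleBdd_one M.vac_act)
    (fun u' hu' v hv n u hu => M.isTripleBdd_coeff hloc hv hu hu' n)
  have : v ∈ N := hN ▸ Submodule.mem_top
  exact this

/-- The induction step in the left factor: `x'` is merged into `x` in
`Y_W(u,x') Y_W(v,x) ξ(z)`. -/
theorem isPairBdd_coeff (M : PhiQuasiModule A W) {u v : V}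
    (ht : IsTripleBdd Γ ξ (M.YW u) (M.YW v)) (hv : IsPairBdd Γ ξ (M.YW v)) (n : ℤ) :
    IsPairBdd Γ ξ (M.YW ((A.Y u v).coeff n)) := by
  obtain ⟨p, hp, hpE⟩ := ht
  obtain ⟨q, hq, hqE⟩ := hv
  obtain ⟨h, c, hL, hc⟩ := M.exists_coeff_eq_finsum u v n
  refine ⟨q * p ^ (c.natDegree + 1), hq.mul (hp.pow _), fun t => ?_⟩
  set E := tripleSeries (M.YW u) (M.YW v) (ξ t) with hE
  set E' := polShift h (1, -1, 0) E with hE'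
  have hE'_apply : ∀ m j l, E' (m, j, l) =
      polShift h (1, -1) (fieldMul (M.YW u) (M.YW v) (ξ t l)) (m, j) := by
    intro m j l
    simp [hE', hE, polShift_apply, fieldMul, tripleSeries]
  let σ : ℤ × ℤ →+ ℤ × ℤ × ℤ := AddMonoidHom.inr ℤ (ℤ × ℤ)
  let δ : ℤ × ℤ × ℤ := (1, -1, 0)
  have hσ : ∀ (k : ℤ × ℤ) (m : ℤ), σ k + m • δ = (m, k.1 - m, k.2) := by
    intro k m
    ext <;> simp [σ, δ, sub_eq_add_neg]
  have hfib : E' ∈ fibreFinite W σ δ := by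
    intro k
    refine ((hL (ξ t k.2)).finite_antidiagonal k.1).subset fun m hm h0 => hm ?_
    simp only at h0 ⊢
    rw [hσ, hE'_apply, h0]
  have hdiag : weightedDiag σ δ c E' =
      fun e : ℤ × ℤ => (M.YW ((A.Y u v).coeff n) (ξ t e.2)).coeff e.1 := by
    ext k
    rw [hc]
    refine finsum_congr fun m => ?_
    rw [hσ, hE'_apply]
  -- boundedness in the second variable
  have hsnd : polShift q (0, 1, -1) E ∈ bddBelow
      ((AddMonoidHom.fst ℤ ℤ).comp (AddMonoidHom.snd ℤ (ℤ × ℤ))) := by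
    obtain ⟨N, hN⟩ := hqE t
    refine ⟨N, fun e he => ?_⟩
    have h1 := congrArg (fun w => (M.YW u w).coeff e.1) (hN e.2 he)
    simp only [polShift_apply, map_sum, map_smul, map_zero, HahnSeries.coeff_sum,
      HahnSeries.coeff_smul, HahnSeries.coeff_zero] at h1
    rw [polShift_apply, ← h1]
    simp [hE, tripleSeries]
  set E'' := polShift q (0, 1, -1) (polShift p (1, 0, -1) E') with hE''
  have hsnd' : E'' ∈ bddBelow
      ((AddMonoidHom.fst ℤ ℤ).comp (AddMonoidHom.snd ℤ (ℤ × ℤ))) := by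
    rw [hE'', hE', polShift_comm q p, polShift_comm q h]
    exact polShift_mem_bddBelow _ _ _ (polShift_mem_bddBelow _ _ _ hsnd)
  -- boundedness in the first variable: the factor `p(x'/x)` is superfluous after multiplication by
  -- `h(x'/x)`, since for a fixed exponent of `z` the series is already bounded below in `x'`
  have hfst' : E'' ∈ bddBelow (AddMonoidHom.fst ℤ (ℤ × ℤ)) := by
    refine mem_bddBelow_of_polShift _ p hp.coeff_zero_ne_zero (1, -1, 0) (by simp) ?_ ?_
    · rw [hE'', hE', polShift_comm p q, polShift_comm p h, polShift_comm p h]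
      exact polShift_mem_bddBelow _ _ _ (polShift_mem_bddBelow _ _ _ (hpE t))
    · have hs : E' ∈ bddBelowOnFibres W (AddMonoidHom.fst ℤ (ℤ × ℤ))
          ((AddMonoidHom.snd ℤ ℤ).comp (AddMonoidHom.snd ℤ (ℤ × ℤ))) := by
        intro l
        obtain ⟨N, hN⟩ := ((isLaurent_iff _).1 (hL (ξ t l))).1
        refine ⟨N, ?_⟩
        rintro ⟨m, j, _⟩ rfl hm
        rw [hE'_apply]
        exact hN _ hm
      have hs' := polShift_mem_bddBelowOnFibres _ _ q (0, 1, -1)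
        (polShift_mem_bddBelowOnFibres _ _ p (1, 0, -1) hs)
      intro e
      obtain ⟨N, hN⟩ := hs' e.2.2
      refine ⟨(e.1 - N).toNat + 1, fun k hk => hN _ (by simp) ?_⟩
      simp
      omega
  let B : Submodule ℂ (ℤ × ℤ → W) := (bddBelow (AddMonoidHom.fst ℤ ℤ)).comap
    (polShift q (1, -1))
  have hB : ∀ f, f ∈ B ↔ polShift q (1, -1) f ∈ bddBelow (AddMonoidHom.fst ℤ ℤ) :=
    fun f => Iff.rfl
  have hmain := polShift_pow_weightedDiag_mem (σ := σ) (δ := δ) B (1, -1) (by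
    intro f hf
    rw [hB, shift_eq_polShift_X, polShift_comm q X]
    exact polShift_mem_bddBelow _ _ _ hf) 1 p hfib (by
    intro c
    have s1 : σ (1, -1) = (0, 1, -1) := rfl
    have s3 : σ (1, -1) + (1 : ℤ) • δ = (1, 0, -1) := rfl
    rw [hB, ← weightedDiag_polShift_map _ _ _ (polShift_mem_fibreFinite (1, -1) 1 p hfib), s3, s1,
      ← hE'']
    obtain ⟨N, hN⟩ := hfst'
    obtain ⟨N', hN'⟩ := hsnd'
    refine ⟨N + N', fun k hk => (finsum_congr fun m => ?_).trans finsum_zero⟩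
    rw [hσ]
    simp only [AddMonoidHom.coe_fst] at hk
    by_cases hm : m < N
    · rw [hN _ hm, smul_zero]
    · rw [hN' (m, k.1 - m, k.2) (by simp; omega), smul_zero]) c
  rw [hdiag, hB] at hmain
  rwa [polShift_mul]

theorem isPairBdd (M : PhiQuasiModule A W) {U : Set V} (hU : A.IsGenerating U)
    (hloc : IsQuasiTrigLocal Γ {a | ∃ u ∈ U, M.YW u = a}) (u v : V) :
    IsPairBdd Γ (fun w n => (M.YW v w).coeff n) (M.YW u) := by
  -- the triple products with a constant last factor give the pairs with `u ∈ U` and `v` arbitrary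
  have h1 : ∀ u ∈ U, IsPairBdd Γ (fun w n => (M.YW v w).coeff n) (M.YW u) := fun u hu =>
    (M.isTripleBdd hU hloc (fun u _ => isPairBdd_single (M.YW u)) v u hu).isPairBdd
  let N : Submodule ℂ V :=
    { carrier := {u | IsPairBdd Γ (fun w n => (M.YW v w).coeff n) (M.YW u)}
      zero_mem' := by
        change IsPairBdd _ _ _
        rw [map_zero]
        exact isPairBdd_zero
      add_mem' := fun {a b} ha hb => by
        change IsPairBdd _ _ (M.YW (a + b))
        rw [map_add]
        exact IsPairBdd.add ha hb
      smul_mem' := fun c a ha => by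
        change IsPairBdd _ _ (M.YW (c • a))
        rw [map_smul]
        exact IsPairBdd.smul c ha }
  have hN : N = ⊤ := by
    refine hU.eq_top N ?_ fun u hu u' hu' n =>
      M.isPairBdd_coeff (M.isTripleBdd hU hloc h1 u' u hu) hu' n
    refine ⟨1, ZerosIn.one, fun w => ?_⟩
    rw [polShift_one]
    refine ⟨0, fun e he => ?_⟩
    simp only [M.vac_act]
    exact HahnSeries.coeff_single_of_ne (ne_of_lt he)
  have : u ∈ N := hN ▸ Submodule.mem_top
  exact this

theorem exists_isCompatibleWith (M : PhiQuasiModule A W) {U : Set V} (hU : A.IsGenerating U)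
    (hloc : IsQuasiTrigLocal Γ {a | ∃ u ∈ U, M.YW u = a}) (u v : V) :
    ∃ p : ℂ[X], ZerosIn Γ p ∧ IsCompatibleWith p (M.YW u) (M.YW v) := by
  obtain ⟨p, hp, h⟩ := M.isPairBdd hU hloc u v
  refine ⟨p, hp, fun w => ?_⟩
  rw [mulSeries_polyRatio, isLaurent_iff]
  refine ⟨h w, polShift_mem_bddBelow _ _ _ ?_⟩
  obtain ⟨N, hN⟩ := exists_coeff_eq_zero_of_lt (M.YW v w)
  exact ⟨N, fun e he => by
    rw [fieldMul, hN e.2 he, map_zero, HahnSeries.coeff_zero]⟩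

end PhiQuasiModule

end Products

end PhiQVA

theorem lemma4p20 {V : Type*} [AddCommGroup V] [Module ℂ V] (A : PhiQVA.WeakQVA V)
    (hT : A.IsTType)
    {G : Type*} [Group G] (ρ : G →* A.Aut) (χ : G →* ℂˣ)
    {W : Type*} [AddCommGroup W] [Module ℂ W] (M : PhiQVA.PhiQuasiModule A W)
    (U : Set V) (hU : A.IsGenerating U)
    (hcov : ∀ u ∈ U, ∀ g : G, M.YW ((ρ g : V ≃ₗ[ℂ] V) u) = (M.YW u).scale (χ g))
    (hloc : PhiQVA.IsQuasiTrigLocal χ.range {a | ∃ u ∈ U, M.YW u = a}) :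
    M.IsCovariant ρ χ := by
  exact ⟨M.YW_apply_eq_scale ρ χ hU hcov, M.exists_isCompatibleWith hU hloc⟩
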